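/- Setting. Let $n,d\ge 1$, let $f_1,\dots,f_n:\mathbb R^d\to\mathbb R$ be differentiable with $\|\nabla f_i(x)-\nabla f_i(y)\|\le L\|x-y\|$ for all $x,y$ and some $L>0$, let $f=\frac1n\sum_i f_i$, and let $h:\mathbb R^d\to(-\infty,+\infty]$ be convex and such that $h+\frac1{2\lambda}\|\cdot-x\|^2$ has a minimizer $\mathrm{prox}_{\lambda h}(x)$ for all $x\in\mathbb R^d$, $\lambda>0$. Let $F=f+h$ attain its minimum $\min F$, and let $F(x_0^0)<\infty$. Let $1\le \ell\le d$, let $b,m\ge1$ be integers with $m\ge\sqrt b$, let $\gamma=\frac{\sqrt{\ell b}}{10Lm\sqrt d}$ and $\beta_\tau>0$. For an orthogonal matrix $G$ put $$g(x,\beta)=\sum_{j=1}^d\tfrac{f(x+\beta e_j)-f(x)}{\beta}e_j,\qquad \hat g_i(x,G,\beta)=\tfrac d\ell\sum_{j=1}^{\ell}\tfrac{f_i(x+\beta Ge_j)-f_i(x)}{\beta}Ge_j .$$ The algorithm does, for $\tau=0,1,\dots,T$ and $k=0,\dots,m-1$, $$v_k^\tau=\tfrac1b\sum_{j=1}^b\big(\hat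 g_{i_j}(x_k^\tau,G_j,\beta_\tau)-\hat g_{i_j}(x_0^\tau,G_j,\beta_\tau)\big)+g(x_0^\tau,\beta_\tau),\qquad x_{k+1}^\tau=\mathrm{prox}_{\gamma h}(x_k^\tau-\gamma v_k^\tau),$$ and $x_0^{\tau+1}=x_m^\tau$, where in each inner iteration the $b$ pairs $(i_j,G_j)$ are drawn afresh and independently from the uniform distribution on $\{1,\dots,n\}\times O(d)$ (normalized Haar measure on $O(d)$). Let $\mathcal G_\gamma(x)=\frac1\gamma\big(x-\mathrm{prox}_{\gamma h}(x-\gamma\nabla f(x))\big)$ and $\eta_m^T=\frac1{(T+1)m}\sum_{\tau=0}^T\sum_{k=0}^{m-1}\mathbb E\|\mathcal G_\gamma(x_k^\tau)\|^2$. Write $D=F(x_0^0)-\min F$, $A=\frac{3d}{\ell b}+2+3d$, $C_2=4AL^2/d$, $C_3=4AL^2d$, $\Delta=\frac12-L\gamma$. Claim. For every choice of the $\beta_\tau>0$ the random variables $\|\mathcal G_\gamma(x_k^\tau)\|^2$, $k<m$, are integrable, and: (i) If $\beta_\tau=\frac\beta d(\tau+1)^{-\alpha}$ with $\alpha>1/2$,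 $\beta>0$, then for all $T\ge0$ $$\eta_m^T\le 40\frac{L\sqrt d}{\sqrt{\ell b}}\,\frac{D}{T+1}+O\!\left(\frac1{T+1}\right);$$ more precisely the last term is at most $K_\alpha\frac{AL^2\beta^2}{d}\cdot\frac1{T+1}$ with $K_\alpha$ depending only on $\alpha$. (ii) If $\beta_\tau=\frac\beta d$ with $\beta>0$, then $\eta_m^T\le 40\frac{L\sqrt d}{\sqrt{\ell b}}\frac{D}{T+1}+C_2\beta^2$ for all $T\ge0$. (iii) Let $\varepsilon\in(0,1)$ and $\beta_\tau=\sqrt{\varepsilon/(2C_3)}$. Then $\eta_m^T\le\varepsilon$ for every $T$ with $$T+1\ge\frac{80L\sqrt d\,D}{\sqrt{\ell b}\,\Delta}\,\varepsilon^{-1}.\qquad(*)$$ Moreover there is a $T\ge1$ with $(*)$ (so $\eta_m^T\le\varepsilon$) for which the outer iterations $0,\dots,T$ use, for every realization of the samples, at most $$K(1+LD)\left(\left(n\frac{d\sqrt d}{\sqrt{\ell b}}+\frac{mb(\ell+1)\sqrt d}{\sqrt{\ell b}}\right)\varepsilon^{-1}+nd+mb(\ell+1)\right)$$ evaluations of the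 functions $f_i$, and, if $\varepsilon\le\sqrt d/\sqrt{\ell b}$, at most $$K(1+LD)\left(n\frac{d\sqrt d}{\sqrt{\ell b}}+\frac{mb(\ell+1)\sqrt d}{\sqrt{\ell b}}\right)\varepsilon^{-1},$$ where $K$ is an absolute constant. In particular, if $b=\lceil n^{2/3}\rceil$, $m=\lceil\sqrt b\rceil$, $\ell=\lceil d/c\rceil$ for some $c>0$ (with $\ell\le d$), then there is a $T\ge1$ with $(*)$ for which this number is at most $K_c(1+LD)\big(dn^{2/3}\varepsilon^{-1}+nd\big)$ and, if $\varepsilon\le n^{-1/3}$, at most $K_c(1+LD)\,dn^{2/3}\varepsilon^{-1}$, where $K_c$ depends only on $c$. -/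

import Mathlib

open MeasureTheory ProbabilityTheory

universe u

noncomputable section

namespace VRSZD

/-- The Euclidean space `ℝ^d`. -/
abbrev Vec (d : ℕ) : Type := EuclideanSpace ℝ (Fin d)

/-- The orthogonal group `O(d)` of real `d × d` matrices. -/
abbrev Orth (d : ℕ) : Type := Matrix.orthogonalGroup (Fin d) ℝ

/-- The Borel sigma-algebra of `O(d)`. -/
instance Orth.instMeasurableSpace (d : ℕ) : MeasurableSpace (Orth d) := borel _

instance Orth.instBorelSpace (d : ℕ) : BorelSpace (Orth d) := ⟨rfl⟩

instance Orth.instCompactSpace (d : ℕ) : CompactSpace (Orth d) := by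
  apply isCompact_iff_compactSpace.mp
  refine (isCompact_univ_pi (X := fun _ : Fin d => Fin d → ℝ) (fun _ => isCompact_univ_pi
    (fun _ => isCompact_Icc (a := (-1 : ℝ)) (b := 1)))).of_isClosed_subset ?_ ?_
  · have h1 : (Matrix.orthogonalGroup (Fin d) ℝ : Set (Matrix (Fin d) (Fin d) ℝ))
        = {A | A * star A = 1} := by
      ext A
      exact Matrix.mem_orthogonalGroup_iff (Fin d) ℝ
    have h2 : IsClosed {A : Matrix (Fin d) (Fin d) ℝ | A * star A = 1} :=
      isClosed_eq (by fun_prop) continuous_const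
    rw [← h1] at h2
    exact h2
  · intro A hA i _ j _
    have := entry_norm_bound_of_unitary (𝕜 := ℝ) hA i j
    rwa [Real.norm_eq_abs, abs_le] at this

/-- The uniform distribution on `O(d)`: the Haar measure of total mass one. -/
def orthUniform (d : ℕ) : Measure (Orth d) := Measure.haarMeasure ⊤

/-- The `j`-th canonical basis vector. -/
def basisVec {d : ℕ} (j : Fin d) : Vec d := EuclideanSpace.single j 1

/-- The vector `G e_j`, the `j`-th column of `G`. -/
def Orth.col {d : ℕ} (G : Orth d) (j : Fin d) : Vec d :=
  WithLp.toLp 2 (fun r => (G : Matrix (Fin d) (Fin d) ℝ) r j)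

/-- The result of a computation together with the number of evaluations of the component functions
that it has made. -/
structure Counted (α : Type) where
  val : α
  cost : ℕ

/-- Sequential composition: results are passed on, costs are added up. -/
instance Counted.instMonad : Monad Counted where
  pure a := ⟨a, 0⟩
  bind c k := ⟨(k c.val).val, c.cost + (k c.val).cost⟩

/-- Run all computations `c i`, `i ∈ s`, and return the sum of their results. -/
def Counted.sum {ι M : Type} [AddCommMonoid M] (s : Finset ι) (c : ι → Counted M) : Counted M :=
  ⟨∑ i ∈ s, (c i).val, ∑ i ∈ s, (c i).cost⟩

/-- All the data of a run of the algorithm. The extended-valued function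
`h : ℝ^d → (-∞, +∞]` is given by its effective domain `dom` and by its finite values there
(the values of the real function `h` outside `dom` play no role: the function is `+∞` there).
`sample τ k j ω` is the pair (index, orthogonal matrix) drawn as `j`-th element of the batch in
inner iteration `k` of outer iteration `τ`. -/
structure Setting : Type (u + 1) where
  /-- dimension -/
  d : ℕ
  /-- number of component functions -/
  n : ℕ
  /-- number of inner iterations -/
  m : ℕ
  /-- batch size -/
  b : ℕ
  /-- number of directions -/
  l : ℕ
  /-- smoothness constant -/
  L : ℝ
  f : Fin n → Vec d → ℝ
  dom : Set (Vec d)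
  h : Vec d → ℝ
  /-- the minimum of the objective function -/
  Fmin : ℝ
  /-- the initial point -/
  start : Vec d
  Ω : Type u
  mΩ : MeasurableSpace Ω
  P : Measure Ω
  sample : ℕ → ℕ → Fin b → Ω → Fin n × Orth d

attribute [instance] Setting.mΩ

namespace Setting

variable (S : Setting.{u})

/-- The smooth part `f = (1/n) ∑ f_i`. -/
def avg (x : Vec S.d) : ℝ := (1 / (S.n : ℝ)) * ∑ i, S.f i x

/-- The objective function `F = f + h` (on `dom`). -/
def F (x : Vec S.d) : ℝ := S.avg x + S.h x

/-- `y` minimizes `w ↦ h w + ‖w - x‖² / (2 γ)`. -/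
def IsProx (γ : ℝ) (x y : Vec S.d) : Prop :=
  y ∈ S.dom ∧ ∀ w ∈ S.dom,
    S.h y + 1 / (2 * γ) * ‖y - x‖ ^ 2 ≤ S.h w + 1 / (2 * γ) * ‖w - x‖ ^ 2

/-- The proximal operator `prox_{γ h}`. -/
def prox (γ : ℝ) (x : Vec S.d) : Vec S.d := Classical.epsilon (S.IsProx γ x)

/-- The gradient mapping `𝒢_γ(x) = (x - prox_{γ h}(x - γ ∇f(x))) / γ`. -/
def gradMap (γ : ℝ) (x : Vec S.d) : Vec S.d :=
  (1 / γ) • (x - S.prox γ (x - γ • gradient S.avg x))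

/-- The step size `γ = √(ℓ b) / (10 L m √d)`. -/
def γ : ℝ := Real.sqrt (S.l * S.b) / (10 * S.L * S.m * Real.sqrt S.d)

/-- The standing assumptions. -/
structure Valid : Prop where
  n_pos : 0 < S.n
  m_pos : 0 < S.m
  b_pos : 0 < S.b
  l_pos : 1 ≤ S.l
  l_le : S.l ≤ S.d
  sqrt_b_le : Real.sqrt S.b ≤ S.m
  L_pos : 0 < S.L
  /-- every `f_i` is `L`-smooth -/
  differentiable : ∀ i, Differentiable ℝ (S.f i)
  smooth : ∀ i x y, ‖gradient (S.f i) x - gradient (S.f i) y‖ ≤ S.L * ‖x - y‖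
  /-- `h` is convex -/
  convex : ConvexOn ℝ S.dom S.h
  /-- `h` is proximable -/
  proximable : ∀ γ : ℝ, 0 < γ → ∀ x, ∃ y, S.IsProx γ x y
  /-- the objective function has a minimum, with value `Fmin` -/
  min : IsLeast (S.F '' S.dom) S.Fmin
  /-- the objective function is finite at the initial point -/
  start_mem : S.start ∈ S.dom
  prob : IsProbabilityMeasure S.P
  measurable : ∀ (τ : ℕ) (k : Fin S.m) (j : Fin S.b), Measurable (S.sample τ k j)
  /-- every drawn pair is uniform on `[n] × O(d)` -/
  law : ∀ (τ : ℕ) (k : Fin S.m) (j : Fin S.b),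
    S.P.map (S.sample τ k j) =
      (uniformOn (Set.univ : Set (Fin S.n))).prod (orthUniform S.d)
  /-- all the drawn pairs are mutually independent -/
  indep : iIndepFun (fun p : ℕ × Fin S.m × Fin S.b => S.sample p.1 p.2.1 p.2.2) S.P

/-- One evaluation of a component function. -/
def query (i : Fin S.n) (x : Vec S.d) : Counted ℝ := ⟨S.f i x, 1⟩

/-- Evaluation of `f = (1/n) ∑ f_i` by evaluation of all the component functions. -/
def queryAvg (x : Vec S.d) : Counted ℝ := do
  let s ← Counted.sum Finset.univ (fun i => S.query i x)
  return (1 / (S.n : ℝ)) * s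

/-- The full finite-difference surrogate
`g(x, β) = ∑_{j ≤ d} (f(x + β e_j) - f(x)) / β e_j`. -/
def fullGrad (β : ℝ) (x : Vec S.d) : Counted (Vec S.d) := do
  let fx ← S.queryAvg x
  Counted.sum Finset.univ (fun j : Fin S.d => do
    let y ← S.queryAvg (x + β • basisVec j)
    return ((y - fx) / β) • basisVec j)

/-- The structured finite-difference surrogate
`ĝ_i(x, G, β) = (d/ℓ) ∑_{j ≤ ℓ} (f_i(x + β G e_j) - f_i(x)) / β G e_j`. -/
def stochGrad (β : ℝ) (z : Fin S.n × Orth S.d) (x : Vec S.d) : Counted (Vec S.d) := do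
  let fx ← S.query z.1 x
  let s ← Counted.sum (Finset.univ.filter (fun j : Fin S.d => (j : ℕ) < S.l)) (fun j => do
    let y ← S.query z.1 (x + β • z.2.col j)
    return ((y - fx) / β) • z.2.col j)
  return ((S.d : ℝ) / (S.l : ℝ)) • s

/-- The search direction
`v = (1/b) ∑_{j ≤ b} (ĝ_{i_j}(x, G_j, β) - ĝ_{i_j}(x₀, G_j, β)) + g`. -/
def direction (β : ℝ) (g x₀ x : Vec S.d) (z : Fin S.b → Fin S.n × Orth S.d) :
    Counted (Vec S.d) := do
  let s ← Counted.sum Finset.univ (fun j => do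
    let p ← S.stochGrad β (z j) x
    let q ← S.stochGrad β (z j) x₀
    return p - q)
  return (1 / (S.b : ℝ)) • s + g

/-- The first `k` steps of the inner loop of outer iteration `τ`, started at `x₀`. -/
def inner (β : ℝ) (g x₀ : Vec S.d) (τ : ℕ) (ω : S.Ω) : ℕ → Counted (Vec S.d)
  | 0 => return x₀
  | k + 1 => do
    let x ← inner β g x₀ τ ω k
    let v ← S.direction β g x₀ x (fun j => S.sample τ k j ω)
    return S.prox S.γ (x - S.γ • v)

/-- The first `τ` outer iterations of the algorithm with discretization parameters `β`;
the result is the outer iterate `x_0^τ`. -/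
def outer (β : ℕ → ℝ) (ω : S.Ω) : ℕ → Counted (Vec S.d)
  | 0 => return S.start
  | τ + 1 => do
    let x₀ ← outer β ω τ
    let g ← S.fullGrad (β τ) x₀
    S.inner (β τ) g x₀ τ ω S.m

/-- The iterate `x_k^τ`. -/
def iter (β : ℕ → ℝ) (τ k : ℕ) (ω : S.Ω) : Vec S.d :=
  let x₀ := (S.outer β ω τ).val
  (S.inner (β τ) (S.fullGrad (β τ) x₀).val x₀ τ ω k).val

/-- The number of evaluations of component functions made by the algorithm in the outer iterations
`0, …, T`. -/
def evals (β : ℕ → ℝ) (T : ℕ) (ω : S.Ω) : ℕ := (S.outer β ω (T + 1)).cost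

/-- The convergence measure
`η_m^T = 1 / ((T + 1) m) ∑_{τ ≤ T} ∑_{k < m} 𝔼 ‖𝒢_γ(x_k^τ)‖²`. -/
def eta (β : ℕ → ℝ) (T : ℕ) : ℝ :=
  1 / (((T : ℝ) + 1) * S.m) * ∑ τ ∈ Finset.range (T + 1), ∑ k ∈ Finset.range S.m,
    ∫ ω, ‖S.gradMap S.γ (S.iter β τ k ω)‖ ^ 2 ∂S.P

/-- The constant `3 d / (ℓ b) + 2 + 3 d`. -/
def A : ℝ := 3 * (S.d : ℝ) / ((S.l : ℝ) * S.b) + 2 + 3 * S.d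

/-- `C₃ = 4 (3 d / (ℓ b) + 2 + 3 d) L² d`. -/
def C₃ : ℝ := 4 * S.A * S.L ^ 2 * S.d

/-- `Δ = 1/2 - L γ`. -/
def Δ : ℝ := 1 / 2 - S.L * S.γ

/-- The constant discretization sequence `β_τ = √(ε / (2 C₃))`. -/
def betaEps (ε : ℝ) : ℕ → ℝ := fun _ => Real.sqrt (ε / (2 * S.C₃))

/-- The prescribed lower bound
`80 L √d (F(x_0^0) - min F) / (√(ℓ b) Δ) ε⁻¹` for the number `T + 1` of outer iterations. -/
def outerBound (ε : ℝ) : ℝ :=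
  80 * S.L * Real.sqrt S.d * (S.F S.start - S.Fmin) / (Real.sqrt (S.l * S.b) * S.Δ) * ε⁻¹

/-- The leading term of the bounds,
`40 L √d / √(ℓ b) (F(x_0^0) - min F) / (T + 1)`. -/
def rate (T : ℕ) : ℝ :=
  40 * (S.L * Real.sqrt S.d / Real.sqrt (S.l * S.b)) * ((S.F S.start - S.Fmin) / ((T : ℝ) + 1))

/-- The complexity
`n d √d / √(ℓ b) + m b (ℓ + 1) √d / √(ℓ b)`, without the factor `ε⁻¹`. -/
def complexity : ℝ :=
  (S.n : ℝ) * ((S.d : ℝ) * Real.sqrt S.d / Real.sqrt (S.l * S.b)) +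
    (S.m : ℝ) * S.b * ((S.l : ℝ) + 1) * Real.sqrt S.d / Real.sqrt (S.l * S.b)

end Setting

end VRSZD

end

/-! The argument is a descent estimate for the objective along the proximal steps. With the inexact
direction `v`, one step lowers `F` by `γ/2` times the squared gradient mapping plus a multiple of
the squared step length, at the price of `γ/2 * ‖v - ∇f‖²` (`prox_step_decrease`).

The price is bounded in mean by `integral_norm_direction_sub_sq_le`. Difference quotients equal
directional derivatives up to `Lβ/2`, so all biases are of order `dLβ`. A column of a Haar matrix is
isotropic, hence the linearized surrogate is unbiased; orthonormality of the columns keeps the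
second moment of a difference of surrogates at order `(d/ℓ) L² ‖x - x₀‖²` plus a `β²` term, and
averaging over the batch divides this by `b`. Conditioning on the past is legitimate because the
batch is independent of earlier iterates, and integrability is automatic: steps are continuous and
`O(d)` is compact, so every iterate stays in a compact set.

The drift `‖x_k - x_0‖²`, summed over an inner loop, is at most `m²` times the sum of squared steps.
The step size satisfies `γ² (d/(ℓb)) L² m² = 1/100`, so the step-length gain of the descent absorbs
it. What remains telescopes over the whole run to `eta_le`, from which (i), (ii) and the accuracy in
(iii) follow by inserting `β_τ`. The complexity is an exact count of evaluations times an admissible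
number of outer iterations. -/

/-! ### Smooth functions and proximal steps in Hilbert spaces -/

section Hilbert

variable {E : Type*} [NormedAddCommGroup E] [InnerProductSpace ℝ E]

/-- The first-order Taylor estimate for a function with Lipschitz gradient. -/
theorem abs_sub_sub_inner_gradient_le [CompleteSpace E] {f : E → ℝ} {L : ℝ}
    (hf : Differentiable ℝ f)
    (hL : ∀ x y, ‖gradient f x - gradient f y‖ ≤ L * ‖x - y‖) (x v : E) :
    |f (x + v) - f x - inner ℝ (gradient f x) v| ≤ L / 2 * ‖v‖ ^ 2 := by
  -- The Taylor remainder along the segment has derivative at most `L‖v‖²t` in absolute value, so it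
  -- is dominated by `L/2 * ‖v‖² * t²`.
  have hd : ∀ t : ℝ, HasDerivAt
      (fun t : ℝ => f (x + t • v) - f x - t * inner ℝ (gradient f x) v)
      (inner ℝ (gradient f (x + t • v) - gradient f x) v) t := by
    intro t
    have h1 : HasDerivAt (fun t : ℝ => x + t • v) v t := by
      simpa using ((hasDerivAt_id t).smul_const v).const_add x
    have h2 := ((hf (x + t • v)).hasGradientAt.hasFDerivAt).comp_hasDerivAt t h1
    have h3 := (h2.sub_const (f x)).sub
      ((hasDerivAt_id t).mul_const (inner ℝ (gradient f x) v))
    rw [one_mul] at h3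
    rw [inner_sub_left]
    exact h3
  have hB : ∀ t : ℝ, HasDerivAt (fun t : ℝ => L / 2 * ‖v‖ ^ 2 * t ^ 2) (L * ‖v‖ ^ 2 * t) t := by
    intro t
    have := (hasDerivAt_pow 2 t).const_mul (L / 2 * ‖v‖ ^ 2)
    rwa [show L / 2 * ‖v‖ ^ 2 * (((2 : ℕ) : ℝ) * t ^ (2 - 1)) = L * ‖v‖ ^ 2 * t by
      norm_num; ring] at this
  have := image_norm_le_of_norm_deriv_right_le_deriv_boundary (a := 0) (b := 1)
    (fun t _ => (hd t).continuousAt.continuousWithinAt)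
    (fun t _ => (hd t).hasDerivWithinAt) (by simp) hB (fun t ht => ?_)
    (Set.right_mem_Icc.2 zero_le_one)
  · simpa using this
  · calc ‖inner ℝ (gradient f (x + t • v) - gradient f x) v‖
        ≤ ‖gradient f (x + t • v) - gradient f x‖ * ‖v‖ := norm_inner_le_norm _ _
      _ ≤ L * ‖x + t • v - x‖ * ‖v‖ := by gcongr; exact hL _ _
      _ = L * ‖v‖ ^ 2 * t := by
        rw [add_sub_cancel_left, norm_smul, Real.norm_of_nonneg ht.1]; ring

/-- A minimizer of `h + ‖· - x‖² / (2 γ)` satisfies the variational inequality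
`(x - y) / γ ∈ ∂h(y)`. -/
theorem prox_variational {s : Set E} {h : E → ℝ} (hc : ConvexOn ℝ s h) {γ : ℝ} (hγ : 0 < γ)
    {x y : E} (hy : y ∈ s)
    (hmin : ∀ w ∈ s, h y + 1 / (2 * γ) * ‖y - x‖ ^ 2 ≤ h w + 1 / (2 * γ) * ‖w - x‖ ^ 2)
    {w : E} (hw : w ∈ s) : h y + 1 / γ * inner ℝ (x - y) (w - y) ≤ h w := by
  set K : ℝ := 1 / (2 * γ) * ‖w - y‖ ^ 2 with hK
  set c : ℝ := h y + 1 / γ * inner ℝ (x - y) (w - y) - h w with hcdef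
  have hK0 : 0 ≤ K := by positivity
  -- Comparing `y` with `y + t(w - y)`: convexity is first order in `t`, the leftover quadratic term
  -- second order.
  have key : ∀ t : ℝ, 0 < t → t ≤ 1 → c ≤ t * K := by
    intro t ht ht1
    have e : y + t • (w - y) = (1 - t) • y + t • w := by module
    have hmem : y + t • (w - y) ∈ s := by
      rw [e]; exact hc.1 hy hw (by linarith) ht.le (by ring)
    have h1 := hc.2 hy hw (by linarith : 0 ≤ 1 - t) ht.le (by ring)
    rw [← e] at h1
    have h2 := hmin _ hmem
    have h3 : ‖y + t • (w - y) - x‖ ^ 2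
        = ‖y - x‖ ^ 2 - 2 * t * inner ℝ (x - y) (w - y) + t ^ 2 * ‖w - y‖ ^ 2 := by
      rw [show y + t • (w - y) - x = (y - x) + t • (w - y) by abel, norm_add_sq_real,
        inner_smul_right, norm_smul, mul_pow, Real.norm_eq_abs, sq_abs, ← neg_sub x y,
        inner_neg_left]
      ring
    rw [h3] at h2
    simp only [smul_eq_mul] at h1
    have h4 : t * c ≤ t * (t * K) := by
      have : 1 / γ = 2 * (1 / (2 * γ)) := by field_simp
      rw [hcdef, hK, this]
      nlinarith
    exact le_of_mul_le_mul_left h4 ht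
  have : c ≤ 0 := by
    by_contra! hc0
    -- This `t` replaces the limit `t → 0`: it would give `c(c + K) ≤ cK`, impossible for `c > 0`.
    have h5 := key (c / (c + K)) (by positivity) (by rw [div_le_one (by positivity)]; linarith)
    rw [div_mul_eq_mul_div, le_div_iff₀ (by positivity)] at h5
    nlinarith
  linarith

/-- Solutions of the proximal variational inequality depend on the data in a nonexpansive way. -/
theorem norm_sub_le_of_prox_variational {s : Set E} {h : E → ℝ} {γ : ℝ} (hγ : 0 < γ)
    {x x' y y' : E} (hy : y ∈ s) (hy' : y' ∈ s)
    (hv : ∀ w ∈ s, h y + 1 / γ * inner ℝ (x - y) (w - y) ≤ h w)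
    (hv' : ∀ w ∈ s, h y' + 1 / γ * inner ℝ (x' - y') (w - y') ≤ h w) :
    ‖y - y'‖ ≤ ‖x - x'‖ := by
  -- Each inequality is tested at the other solution; in the sum the values of `h` cancel.
  have h1 := hv _ hy'
  have h2 := hv' _ hy
  have h3 : 1 / γ * (inner ℝ (x - y) (y' - y) + inner ℝ (x' - y') (y - y')) ≤ 0 := by linarith
  have h4 : inner ℝ (x - y) (y' - y) + inner ℝ (x' - y') (y - y') ≤ 0 :=
    nonpos_of_mul_nonpos_right h3 (by positivity)
  have h5 : inner ℝ (x - y) (y' - y) + inner ℝ (x' - y') (y - y')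
      = ‖y - y'‖ ^ 2 - inner ℝ (x - x') (y - y') := by
    rw [← real_inner_self_eq_norm_sq]
    simp only [inner_sub_left, inner_sub_right]
    ring
  have h6 := real_inner_le_norm (x - x') (y - y')
  rcases (norm_nonneg (y - y')).eq_or_lt with h0 | h0
  · rw [← h0]; positivity
  · exact le_of_mul_le_mul_right (by nlinarith) h0

/-- Decrease of the objective in a proximal step `y` along an inexact gradient `v`, compared with
the proximal step `p` along the exact gradient `g`. -/
theorem prox_step_decrease {s : Set E} {f h : E → ℝ} {γ L : ℝ} (hγ : 0 < γ) {x y p g v : E}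
    (hx : x ∈ s) (hp : p ∈ s)
    (hf : f y ≤ f x + inner ℝ g (y - x) + L / 2 * ‖y - x‖ ^ 2)
    (hvy : ∀ w ∈ s, h y + 1 / γ * inner ℝ (x - γ • v - y) (w - y) ≤ h w)
    (hvp : ∀ w ∈ s, h p + 1 / γ * inner ℝ (x - γ • g - p) (w - p) ≤ h w) :
    f y + h y ≤ f x + h x + γ / 2 * ‖v - g‖ ^ 2 - (1 / (2 * γ) - L / 2) * ‖y - x‖ ^ 2
      - 1 / (2 * γ) * ‖x - p‖ ^ 2 := by
  -- The inexact step is compared with the exact one, and the exact one with `x`; this chain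
  -- produces both negative quadratic terms.
  have h1 := hvy p hp
  have h2 := hvp x hx
  obtain ⟨a, rfl⟩ : ∃ a, y = x + a := ⟨y - x, by abel⟩
  obtain ⟨c, rfl⟩ : ∃ c, p = x + c := ⟨p - x, by abel⟩
  obtain ⟨e, rfl⟩ : ∃ e, v = g + e := ⟨v - g, by abel⟩
  have e1 : x - γ • (g + e) - (x + a) = -(a + γ • (g + e)) := by abel
  have e2 : x + c - (x + a) = c - a := by abel
  have e3 : x - γ • g - (x + c) = -(c + γ • g) := by abel
  have e4 : x - (x + c) = -c := by abel
  rw [e1, e2] at h1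
  rw [e3, e4] at h2
  rw [add_sub_cancel_left] at hf
  rw [add_sub_cancel_left, add_sub_cancel_left, e4, norm_neg]
  -- Young's inequality for the cross term between the error `e = v - g` and `y - p = a - c`; the
  -- resulting `‖a - c‖²` is cancelled by polarization of the terms from `h1` and `h2`.
  have h3 : 0 ≤ 1 / (2 * γ) * ‖γ • e + (a - c)‖ ^ 2 := by positivity
  simp only [inner_add_left, inner_sub_right, inner_neg_left, inner_neg_right, inner_smul_left,
    RCLike.conj_to_real, real_inner_self_eq_norm_sq] at h1 h2
  rw [norm_add_sq_real, norm_sub_sq_real, norm_smul, inner_smul_left, inner_sub_right, mul_pow,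
    Real.norm_eq_abs, sq_abs, RCLike.conj_to_real] at h3
  have e5 : 1 / (2 * γ) * (γ ^ 2 * ‖e‖ ^ 2 + 2 * (γ * (inner ℝ e a - inner ℝ e c)) +
      (‖a‖ ^ 2 - 2 * inner ℝ a c + ‖c‖ ^ 2)) = γ / 2 * ‖e‖ ^ 2 + (inner ℝ e a - inner ℝ e c) +
      1 / (2 * γ) * (‖a‖ ^ 2 - 2 * inner ℝ a c + ‖c‖ ^ 2) := by
    field_simp
  have e6 : 1 / γ * (-(inner ℝ a c + γ * (inner ℝ g c + inner ℝ e c)) -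
      -(‖a‖ ^ 2 + γ * (inner ℝ g a + inner ℝ e a))) = 2 * (1 / (2 * γ)) * (‖a‖ ^ 2 - inner ℝ a c)
      + (inner ℝ g a + inner ℝ e a) - (inner ℝ g c + inner ℝ e c) := by
    field_simp
    ring
  have e7 : 1 / γ * - -(‖c‖ ^ 2 + γ * inner ℝ g c)
      = 2 * (1 / (2 * γ)) * ‖c‖ ^ 2 + inner ℝ g c := by
    field_simp
  rw [e5] at h3
  rw [e6] at h1
  rw [e7] at h2
  linarith

end Hilbert

noncomputable section

namespace VRSZD

/-! ### The uniform distribution on the orthogonal group -/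

instance Orth.instSecondCountableTopology (d : ℕ) : SecondCountableTopology (Orth d) :=
  haveI : SecondCountableTopology (Matrix (Fin d) (Fin d) ℝ) :=
    inferInstanceAs (SecondCountableTopology (Fin d → Fin d → ℝ))
  inferInstanceAs (SecondCountableTopology
    {x // x ∈ (Matrix.orthogonalGroup (Fin d) ℝ : Set (Matrix (Fin d) (Fin d) ℝ))})

instance (d : ℕ) : IsProbabilityMeasure (orthUniform d) :=
  ⟨Measure.haarMeasure_self (K₀ := (⊤ : TopologicalSpace.PositiveCompacts (Orth d)))⟩

instance (d : ℕ) : (orthUniform d).IsHaarMeasure :=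
  inferInstanceAs (Measure.haarMeasure _).IsHaarMeasure

/-- A right translate of Haar measure is again left invariant of mass one, so uniqueness applies.
Right invariance is what makes columns exchangeable. -/
instance (d : ℕ) : (orthUniform d).IsMulRightInvariant := by
  refine ⟨fun g => ?_⟩
  have : IsProbabilityMeasure ((orthUniform d).map (· * g)) :=
    Measure.isProbabilityMeasure_map (by fun_prop)
  have h := Measure.haarMeasure_unique ((orthUniform d).map (· * g)) ⊤
  rw [TopologicalSpace.PositiveCompacts.coe_top, measure_univ, one_smul] at h
  exact h

theorem Orth.col_mul_permMatrix {d : ℕ} (G P : Orth d) (σ : Equiv.Perm (Fin d))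
    (hP : (P : Matrix (Fin d) (Fin d) ℝ) = σ.permMatrix ℝ) (j : Fin d) :
    (G * P).col j = G.col (σ.symm j) := by
  ext r
  show ((G : Matrix (Fin d) (Fin d) ℝ) * (P : Matrix (Fin d) (Fin d) ℝ)) r j = _
  rw [hP, Matrix.mul_apply]
  simp [Orth.col, PEquiv.toMatrix_apply, Equiv.Perm.permMatrix, ← Equiv.eq_symm_apply]

theorem permMatrix_mem_orthogonalGroup {d : ℕ} (σ : Equiv.Perm (Fin d)) :
    σ.permMatrix ℝ ∈ Matrix.orthogonalGroup (Fin d) ℝ := by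
  rw [Matrix.mem_orthogonalGroup_iff, Matrix.transpose_permMatrix,
    ← Matrix.permMatrix_mul, inv_mul_cancel, Matrix.permMatrix_one]

theorem Orth.continuous_col {d : ℕ} (j : Fin d) : Continuous (fun G : Orth d => G.col j) := by
  unfold Orth.col
  refine (PiLp.continuous_toLp 2 _).comp (continuous_pi fun r => ?_)
  exact (continuous_apply_apply r j).comp continuous_subtype_val

/-- The columns of an orthogonal matrix satisfy Parseval's identity. -/
theorem Orth.sum_inner_col_mul {d : ℕ} (G : Orth d) (a w : Vec d) :
    ∑ j, inner ℝ a (G.col j) * inner ℝ w (G.col j) = inner ℝ a w := by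
  have hG : (G : Matrix (Fin d) (Fin d) ℝ) * (G : Matrix (Fin d) (Fin d) ℝ).transpose = 1 :=
    (Matrix.mem_orthogonalGroup_iff (Fin d) ℝ).1 G.2
  have h (x : Vec d) (j : Fin d) : inner ℝ x (G.col j) = Matrix.vecMul x.ofLp (G : Matrix (Fin d) (Fin d) ℝ) j := by
    simp [Orth.col, PiLp.inner_apply, Matrix.vecMul, dotProduct, mul_comm]
  simp_rw [h]
  change Matrix.vecMul a.ofLp (G : Matrix (Fin d) (Fin d) ℝ) ⬝ᵥ
    Matrix.vecMul w.ofLp (G : Matrix (Fin d) (Fin d) ℝ) = _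
  rw [← Matrix.mulVec_transpose _ w.ofLp, Matrix.dotProduct_mulVec, Matrix.vecMul_vecMul, hG,
    Matrix.vecMul_one]
  simp [PiLp.inner_apply, dotProduct, mul_comm]

theorem Orth.inner_col_col {d : ℕ} (G : Orth d) (i j : Fin d) :
    inner ℝ (G.col i) (G.col j) = if i = j then 1 else 0 := by
  have hG : (G : Matrix (Fin d) (Fin d) ℝ).transpose * (G : Matrix (Fin d) (Fin d) ℝ) = 1 :=
    (Matrix.mem_orthogonalGroup_iff' (Fin d) ℝ).1 G.2
  have := congrFun (congrFun hG i) j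
  rw [Matrix.mul_apply, Matrix.one_apply] at this
  rw [← this]
  simp [Orth.col, PiLp.inner_apply, mul_comm]

theorem Orth.norm_col {d : ℕ} (G : Orth d) (j : Fin d) : ‖G.col j‖ = 1 := by
  have := G.inner_col_col j j
  rw [real_inner_self_eq_norm_sq, if_pos rfl] at this
  exact (pow_eq_one_iff_of_nonneg (norm_nonneg _) two_ne_zero).1 this

theorem Orth.norm_sum_smul_col_sq {d : ℕ} (G : Orth d) (s : Finset (Fin d)) (c : Fin d → ℝ) :
    ‖∑ j ∈ s, c j • G.col j‖ ^ 2 = ∑ j ∈ s, c j ^ 2 := by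
  rw [← real_inner_self_eq_norm_sq, sum_inner]
  refine Finset.sum_congr rfl fun i hi => ?_
  simp [inner_sum, inner_smul_left, inner_smul_right, Orth.inner_col_col, hi, sq]

/-- A column of a uniform orthogonal matrix is isotropic. -/
theorem integral_inner_col_mul {d : ℕ} (a w : Vec d) (j : Fin d) :
    ∫ G : Orth d, inner ℝ a (G.col j) * inner ℝ w (G.col j) ∂(orthUniform d)
      = inner ℝ a w / d := by
  have hint (i : Fin d) : Integrable
      (fun G : Orth d => inner ℝ a (G.col i) * inner ℝ w (G.col i)) (orthUniform d) := by
    have := Orth.continuous_col i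
    exact Continuous.integrable_of_hasCompactSupport (by fun_prop)
      (HasCompactSupport.of_compactSpace _)
  -- Right multiplication by a transposition swaps columns `i` and `j`, so all columns give the same
  -- integral; by Parseval the `d` integrals add up to `⟨a, w⟩`.
  have hsymm (i : Fin d) :
      ∫ G : Orth d, inner ℝ a (G.col i) * inner ℝ w (G.col i) ∂(orthUniform d)
        = ∫ G : Orth d, inner ℝ a (G.col j) * inner ℝ w (G.col j) ∂(orthUniform d) := by
    rw [← integral_mul_right_eq_self _
      (⟨_, permMatrix_mem_orthogonalGroup (Equiv.swap i j)⟩ : Orth d)]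
    simp_rw [Orth.col_mul_permMatrix _ ⟨_, permMatrix_mem_orthogonalGroup (Equiv.swap i j)⟩
      (Equiv.swap i j) rfl]
    simp
  have h := integral_finsetSum (μ := orthUniform d) Finset.univ (fun i _ => hint i)
  simp_rw [Orth.sum_inner_col_mul, hsymm] at h
  have hd : (d : ℝ) ≠ 0 := by
    have := j.pos
    positivity
  rw [eq_div_iff hd]
  simpa [mul_comm] using h.symm

end VRSZD
end

noncomputable section

namespace VRSZD

/-! ### Second moments of averages of independent samples -/

section Average

variable {Z : Type*} [MeasurableSpace Z] {μ : Measure Z} [IsProbabilityMeasure μ] {b : ℕ}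

theorem memLp_average_add {X : Z → ℝ} (hX : MemLp X 2 μ) (c : ℝ) :
    MemLp (fun z : Fin b → Z => 1 / (b : ℝ) * ∑ j, X (z j) + c) 2
      (Measure.pi fun _ : Fin b => μ) :=
  ((memLp_finsetSum Finset.univ fun j _ =>
    hX.comp_measurePreserving (measurePreserving_eval _ j)).const_mul _).add (memLp_const c)

/-- Bias-variance decomposition: averaging `b` independent copies divides the variance by `b`, and
the variance is at most the second moment. -/
theorem integral_sq_average_add_le (hb : 0 < b) {X : Z → ℝ} (hX : MemLp X 2 μ) (c : ℝ) :
    ∫ z : Fin b → Z, (1 / (b : ℝ) * ∑ j, X (z j) + c) ^ 2 ∂(Measure.pi fun _ : Fin b => μ)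
      ≤ 1 / b * ∫ z, X z ^ 2 ∂μ + (∫ z, X z ∂μ + c) ^ 2 := by
  have hb' : (b : ℝ) ≠ 0 := by positivity
  have hj (j : Fin b) : MemLp (fun z : Fin b → Z => X (z j)) 2 (Measure.pi fun _ : Fin b => μ) :=
    hX.comp_measurePreserving (measurePreserving_eval _ j)
  have hY := memLp_average_add (b := b) hX c
  have hsum : MemLp (fun z : Fin b → Z => 1 / (b : ℝ) * ∑ j, X (z j)) 2
      (Measure.pi fun _ : Fin b => μ) := by
    simpa using memLp_average_add (b := b) hX 0
  have hmean : ∫ z : Fin b → Z, (1 / (b : ℝ) * ∑ j, X (z j) + c)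
      ∂(Measure.pi fun _ : Fin b => μ) = ∫ z, X z ∂μ + c := by
    rw [integral_add (hsum.integrable one_le_two) (integrable_const c), integral_const_mul,
      integral_finsetSum _ (fun j _ => (hj j).integrable one_le_two)]
    simp_rw [integral_comp_eval (μ := fun _ : Fin b => μ) hX.1]
    simp [hb']
  have hvar : Var[fun z : Fin b → Z => 1 / (b : ℝ) * ∑ j, X (z j) + c;
      Measure.pi fun _ : Fin b => μ] = 1 / b * Var[X; μ] := by
    rw [variance_add_const hsum.1, variance_const_mul]
    have := variance_sum_pi (μ := fun _ : Fin b => μ) (X := fun _ => X) (fun _ => hX)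
    rw [show (∑ i : Fin b, fun ω : Fin b → Z => X (ω i)) = fun ω => ∑ i, X (ω i) by
      ext; simp] at this
    rw [this]
    simp
    field_simp
  have h := variance_eq_sub hY
  rw [hmean, hvar] at h
  have h' := variance_le_expectation_sq (μ := μ) hX.1
  have h2 : 1 / (b : ℝ) * Var[X; μ] ≤ 1 / b * ∫ z, X z ^ 2 ∂μ := by
    gcongr
    simpa using h'
  simp only [Pi.pow_apply] at h
  linarith

/-- The second moment of a translated average of independent copies of a random vector. -/
theorem integral_norm_sq_average_add_le (hb : 0 < b) {d : ℕ} {W : Z → Vec d}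
    (hW : MemLp W 2 μ) (c : Vec d) :
    ∫ z : Fin b → Z, ‖(1 / (b : ℝ)) • ∑ j, W (z j) + c‖ ^ 2 ∂(Measure.pi fun _ : Fin b => μ)
      ≤ 1 / b * ∫ z, ‖W z‖ ^ 2 ∂μ + ‖∫ z, W z ∂μ + c‖ ^ 2 := by
  have hr (r : Fin d) : MemLp (fun z => W z r) 2 μ :=
    (EuclideanSpace.proj (𝕜 := ℝ) r).comp_memLp' hW
  have hint (r : Fin d) : (∫ z, W z ∂μ) r = ∫ z, W z r ∂μ :=
    eval_integral_piLp (fun i => (hr i).integrable one_le_two) r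
  simp only [EuclideanSpace.real_norm_sq_eq, PiLp.add_apply, PiLp.smul_apply, WithLp.ofLp_sum,
    Finset.sum_apply, smul_eq_mul, hint]
  rw [integral_finsetSum _ (fun r _ => (memLp_average_add (b := b) (hr r) (c r)).integrable_sq),
    integral_finsetSum _ (fun r _ => (hr r).integrable_sq), Finset.mul_sum,
    ← Finset.sum_add_distrib]
  exact Finset.sum_le_sum fun r _ => integral_sq_average_add_le hb (hr r) (c r)

end Average

theorem integral_uniformOn_univ {n : ℕ} (g : Fin n → ℝ) :
    ∫ i, g i ∂(uniformOn (Set.univ : Set (Fin n))) = 1 / (n : ℝ) * ∑ i, g i := by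
  have h : uniformOn (Set.univ : Set (Fin n)) = (n : ENNReal)⁻¹ • Measure.count := by
    simp [uniformOn, ProbabilityTheory.cond]
  rw [h, integral_smul_measure, integral_count]
  simp

end VRSZD
end

/-! ### Bias and continuity of the finite-difference surrogates -/

noncomputable section

namespace VRSZD

/-- A finite difference quotient along a unit vector approximates the directional derivative. -/
theorem abs_difference_quotient_sub_le {d : ℕ} {f : Vec d → ℝ} {L β : ℝ}
    (hf : Differentiable ℝ f)
    (hL : ∀ x y, ‖gradient f x - gradient f y‖ ≤ L * ‖x - y‖) (hβ : 0 < β) (x : Vec d)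
    {u : Vec d} (hu : ‖u‖ = 1) :
    |(f (x + β • u) - f x) / β - inner ℝ (gradient f x) u| ≤ L * β / 2 := by
  have h := abs_sub_sub_inner_gradient_le hf hL x (β • u)
  rw [inner_smul_right, norm_smul, hu, mul_one, Real.norm_of_nonneg hβ.le] at h
  rw [show (f (x + β • u) - f x) / β - inner ℝ (gradient f x) u
    = (f (x + β • u) - f x - β * inner ℝ (gradient f x) u) / β by field_simp, abs_div,
    abs_of_pos hβ, div_le_iff₀ hβ]
  linarith

theorem norm_basisVec {d : ℕ} (j : Fin d) : ‖(basisVec j : Vec d)‖ = 1 := by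
  simp [basisVec]

theorem sum_inner_smul_basisVec {d : ℕ} (a : Vec d) :
    ∑ j, inner ℝ a (basisVec j) • (basisVec j : Vec d) = a := by
  have := (EuclideanSpace.basisFun (Fin d) ℝ).sum_repr' a
  simp only [EuclideanSpace.basisFun_apply] at this
  conv_rhs => rw [← this]
  simp only [basisVec]
  exact Finset.sum_congr rfl fun j _ => by rw [real_inner_comm]

theorem card_filter_lt {d l : ℕ} (h : l ≤ d) :
    (Finset.univ.filter (fun j : Fin d => (j : ℕ) < l)).card = l := by
  rw [Fin.card_filter_val_lt, min_eq_right h]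

namespace Setting

/-- The uniform distribution of an index and an orthogonal matrix. -/
def sampleLaw (S : Setting.{u}) : Measure (Fin S.n × Orth S.d) :=
  (uniformOn (Set.univ : Set (Fin S.n))).prod (orthUniform S.d)

variable {S : Setting.{u}}

theorem fullGrad_val (β : ℝ) (x : Vec S.d) : (S.fullGrad β x).val =
    ∑ j, ((S.avg (x + β • basisVec j) - S.avg x) / β) • basisVec j := rfl

theorem stochGrad_val (β : ℝ) (z : Fin S.n × Orth S.d) (x : Vec S.d) :
    (S.stochGrad β z x).val = ((S.d : ℝ) / S.l) •
      ∑ j ∈ Finset.univ.filter (fun j : Fin S.d => (j : ℕ) < S.l),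
        ((S.f z.1 (x + β • z.2.col j) - S.f z.1 x) / β) • z.2.col j := rfl

theorem direction_val (β : ℝ) (g x₀ x : Vec S.d) (z : Fin S.b → Fin S.n × Orth S.d) :
    (S.direction β g x₀ x z).val = (1 / (S.b : ℝ)) •
      ∑ j, ((S.stochGrad β (z j) x).val - (S.stochGrad β (z j) x₀).val) + g := rfl

namespace Valid

variable (hS : S.Valid)

include hS

theorem d_pos : 0 < S.d := hS.l_pos.trans hS.l_le

theorem isProbabilityMeasure_uniformOn :
    IsProbabilityMeasure (uniformOn (Set.univ : Set (Fin S.n))) :=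
  haveI : Nonempty (Fin S.n) := ⟨⟨0, hS.n_pos⟩⟩
  ProbabilityTheory.isProbabilityMeasure_uniformOn Set.finite_univ Set.univ_nonempty

theorem isProbabilityMeasure_sampleLaw : IsProbabilityMeasure S.sampleLaw :=
  haveI := hS.isProbabilityMeasure_uniformOn
  inferInstanceAs (IsProbabilityMeasure (Measure.prod _ _))

theorem hasGradientAt_avg (x : Vec S.d) :
    HasGradientAt S.avg ((1 / (S.n : ℝ)) • ∑ i, gradient (S.f i) x) x := by
  have h : HasFDerivAt (fun x => ∑ i, S.f i x) _ x :=
    HasFDerivAt.fun_sum fun i (_ : i ∈ Finset.univ) =>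
      (hS.differentiable i x).hasGradientAt.hasFDerivAt
  have h2 := h.const_mul (1 / (S.n : ℝ))
  rw [hasGradientAt_iff_hasFDerivAt,
    show S.avg = fun x => 1 / (S.n : ℝ) * ∑ i, S.f i x from rfl]
  simpa using h2

theorem gradient_avg (x : Vec S.d) :
    gradient S.avg x = (1 / (S.n : ℝ)) • ∑ i, gradient (S.f i) x :=
  (hS.hasGradientAt_avg x).gradient

theorem differentiable_avg : Differentiable ℝ S.avg :=
  fun x => (hS.hasGradientAt_avg x).differentiableAt

theorem smooth_avg (x y : Vec S.d) :
    ‖gradient S.avg x - gradient S.avg y‖ ≤ S.L * ‖x - y‖ := by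
  have hn : (0 : ℝ) < S.n := by exact_mod_cast hS.n_pos
  rw [hS.gradient_avg, hS.gradient_avg, ← smul_sub, ← Finset.sum_sub_distrib, norm_smul,
    Real.norm_of_nonneg (by positivity)]
  calc 1 / (S.n : ℝ) * ‖∑ i, (gradient (S.f i) x - gradient (S.f i) y)‖
      ≤ 1 / (S.n : ℝ) * ∑ _i : Fin S.n, S.L * ‖x - y‖ := by
        gcongr
        exact (norm_sum_le _ _).trans (Finset.sum_le_sum fun i _ => hS.smooth i x y)
    _ = S.L * ‖x - y‖ := by
        simp
        field_simp

theorem continuous_gradient_avg : Continuous (gradient S.avg) :=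
  (LipschitzWith.of_dist_le_mul (K := ⟨S.L, hS.L_pos.le⟩) fun x y => by
    rw [dist_eq_norm, dist_eq_norm]; exact hS.smooth_avg x y).continuous

/-- The bias of the full finite-difference surrogate. -/
theorem norm_fullGrad_sub_le {β : ℝ} (hβ : 0 < β) (x : Vec S.d) :
    ‖(S.fullGrad β x).val - gradient S.avg x‖ ≤ S.d * (S.L * β / 2) := by
  rw [fullGrad_val]
  conv_lhs => rw [← sum_inner_smul_basisVec (gradient S.avg x), ← Finset.sum_sub_distrib]
  refine (norm_sum_le _ _).trans ((Finset.sum_le_card_nsmul _ _ (S.L * β / 2) fun j _ => ?_).trans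
    (by simp))
  rw [← sub_smul, norm_smul, norm_basisVec, mul_one]
  exact abs_difference_quotient_sub_le hS.differentiable_avg hS.smooth_avg hβ x (norm_basisVec j)

theorem continuous_f (i : Fin S.n) : Continuous (S.f i) := (hS.differentiable i).continuous

theorem continuous_fullGrad (β : ℝ) : Continuous fun x => (S.fullGrad β x).val := by
  have := hS.differentiable_avg.continuous
  simp only [fullGrad_val]
  fun_prop

theorem continuous_stochGrad (β : ℝ) :
    Continuous fun p : (Fin S.n × Orth S.d) × Vec S.d => (S.stochGrad β p.1 p.2).val := by
  have h : Continuous fun p : Fin S.n × (Orth S.d × Vec S.d) =>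
      (S.stochGrad β (p.1, p.2.1) p.2.2).val := by
    -- The index is a discrete variable, so continuity is checked for each fixed component function.
    rw [continuous_prod_of_discrete_left]
    intro i
    have h1 := hS.continuous_f i
    have h2 (j : Fin S.d) := Orth.continuous_col j
    simp only [stochGrad_val]
    fun_prop
  exact h.comp (f := fun p : (Fin S.n × Orth S.d) × Vec S.d => (p.1.1, (p.1.2, p.2)))
    (by fun_prop)

end Valid

end Setting

end VRSZD
end

/-! ### Moments of the structured surrogate and of the search direction -/

noncomputable section

namespace VRSZD

theorem integrable_of_continuous_of_compactSpace {X E : Type*} [TopologicalSpace X]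
    [CompactSpace X] [MeasurableSpace X] [OpensMeasurableSpace X] [NormedAddCommGroup E]
    [SecondCountableTopologyEither X E]
    {μ : Measure X} [IsFiniteMeasure μ] {g : X → E} (hg : Continuous g) : Integrable g μ :=
  hg.integrable_of_hasCompactSupport (HasCompactSupport.of_compactSpace _)

theorem memLp_two_of_continuous_of_compactSpace {X E : Type*} [TopologicalSpace X]
    [CompactSpace X] [MeasurableSpace X] [OpensMeasurableSpace X] [NormedAddCommGroup E]
    [SecondCountableTopologyEither X E]
    {μ : Measure X} [IsFiniteMeasure μ] {g : X → E} (hg : Continuous g) : MemLp g 2 μ :=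
  (memLp_two_iff_integrable_sq_norm hg.aestronglyMeasurable).2
    (integrable_of_continuous_of_compactSpace (by fun_prop))

namespace Setting

variable {S : Setting.{u}}

/-- The linearization of the structured finite-difference surrogate. -/
def stochGradLin (S : Setting.{u}) (z : Fin S.n × Orth S.d) (a : Fin S.n → Vec S.d) : Vec S.d :=
  ((S.d : ℝ) / S.l) • ∑ j ∈ Finset.univ.filter (fun j : Fin S.d => (j : ℕ) < S.l),
    Inner.inner ℝ (a z.1) (z.2.col j) • z.2.col j

namespace Valid

variable (hS : S.Valid)

include hS

theorem l_pos' : (0 : ℝ) < S.l := by exact_mod_cast hS.l_pos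

theorem d_pos' : (0 : ℝ) < S.d := by exact_mod_cast hS.d_pos

theorem integral_inner_col_mul_sampleLaw (a w : Fin S.n → Vec S.d) (j : Fin S.d) :
    ∫ z, Inner.inner ℝ (a z.1) (z.2.col j) * Inner.inner ℝ (w z.1) (z.2.col j) ∂S.sampleLaw
      = 1 / (S.n : ℝ) * ∑ i, Inner.inner ℝ (a i) (w i) / S.d := by
  have := hS.isProbabilityMeasure_uniformOn
  have h1 := Orth.continuous_col j
  rw [sampleLaw, integral_prod _ (integrable_of_continuous_of_compactSpace (by
    rw [continuous_prod_of_discrete_left]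
    intro i
    dsimp only
    fun_prop))]
  simp only [integral_inner_col_mul]
  rw [integral_uniformOn_univ]

omit hS in
theorem continuous_stochGradLin (a : Fin S.n → Vec S.d) :
    Continuous fun z => S.stochGradLin z a := by
  rw [continuous_prod_of_discrete_left]
  intro i
  have h2 (j : Fin S.d) := Orth.continuous_col j
  simp only [stochGradLin]
  fun_prop

/-- The linearization is an unbiased estimator. -/
theorem integral_stochGradLin (a : Fin S.n → Vec S.d) :
    ∫ z, S.stochGradLin z a ∂S.sampleLaw = (1 / (S.n : ℝ)) • ∑ i, a i := by
  have := hS.isProbabilityMeasure_sampleLaw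
  -- Tested against `w`, each of the `ℓ` columns contributes `1/d` of the mean inner product, which
  -- the factor `d/ℓ` undoes.
  refine ext_inner_left ℝ fun w => ?_
  rw [← integral_inner (integrable_of_continuous_of_compactSpace (continuous_stochGradLin a))]
  have h2 (j : Fin S.d) := Orth.continuous_col j
  have hd := hS.d_pos'
  have hl := hS.l_pos'
  simp only [stochGradLin, inner_smul_right, inner_sum]
  rw [integral_const_mul, integral_finsetSum]
  · simp_rw [hS.integral_inner_col_mul_sampleLaw a fun _ => w]
    rw [Finset.sum_const, card_filter_lt hS.l_le, ← Finset.sum_div]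
    simp_rw [real_inner_comm w]
    simp
    field_simp
  · intro j _
    refine integrable_of_continuous_of_compactSpace ?_
    rw [continuous_prod_of_discrete_left]
    intro i
    dsimp only
    fun_prop

/-- Each of the `ℓ` quotients errs by at most `Lβ/2` along a unit column. The bound is uniform in
the sample, so it passes to the mean. -/
theorem norm_stochGrad_sub_le {β : ℝ} (hβ : 0 < β) (z : Fin S.n × Orth S.d) (x : Vec S.d) :
    ‖(S.stochGrad β z x).val - S.stochGradLin z (fun i => gradient (S.f i) x)‖
      ≤ S.d * (S.L * β / 2) := by
  have hd := hS.d_pos'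
  have hl := hS.l_pos'
  rw [stochGrad_val, stochGradLin, ← smul_sub, ← Finset.sum_sub_distrib, norm_smul,
    Real.norm_of_nonneg (by positivity)]
  calc (S.d : ℝ) / S.l * _
      ≤ (S.d : ℝ) / S.l * (S.l • (S.L * β / 2)) := by
        gcongr
        refine (norm_sum_le _ _).trans ?_
        conv_rhs => rw [← card_filter_lt hS.l_le]
        refine Finset.sum_le_card_nsmul _ _ _ fun j _ => ?_
        rw [← sub_smul, norm_smul, Orth.norm_col, mul_one]
        exact abs_difference_quotient_sub_le (hS.differentiable _) (hS.smooth _) hβ x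
          (Orth.norm_col _ j)
    _ = S.d * (S.L * β / 2) := by
        rw [nsmul_eq_mul]
        field_simp

theorem continuous_stochGrad_left (β : ℝ) (x : Vec S.d) :
    Continuous fun z => (S.stochGrad β z x).val :=
  (hS.continuous_stochGrad β).comp (f := fun z => (z, x)) (by fun_prop)

/-- The bias of the structured finite-difference surrogate. -/
theorem norm_integral_stochGrad_sub_le {β : ℝ} (hβ : 0 < β) (x : Vec S.d) :
    ‖∫ z, (S.stochGrad β z x).val ∂S.sampleLaw - gradient S.avg x‖ ≤ S.d * (S.L * β / 2) := by
  have := hS.isProbabilityMeasure_sampleLaw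
  rw [hS.gradient_avg, ← hS.integral_stochGradLin (fun i => gradient (S.f i) x), ← integral_sub
    (integrable_of_continuous_of_compactSpace (hS.continuous_stochGrad_left β x))
    (integrable_of_continuous_of_compactSpace (continuous_stochGradLin _))]
  simpa using norm_integral_le_of_norm_le_const (μ := S.sampleLaw)
    (Filter.Eventually.of_forall fun z => hS.norm_stochGrad_sub_le hβ z x)

/-- Orthonormal columns turn the squared norm into a sum of squared coefficients. The gradient part
is kept as inner products so that isotropy can still be applied to it. -/
theorem norm_stochGrad_sub_sq_le {β : ℝ} (hβ : 0 < β) (z : Fin S.n × Orth S.d) (x y : Vec S.d) :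
    ‖(S.stochGrad β z x).val - (S.stochGrad β z y).val‖ ^ 2 ≤ ((S.d : ℝ) / S.l) ^ 2 *
      ∑ j ∈ Finset.univ.filter (fun j : Fin S.d => (j : ℕ) < S.l),
        (2 * (Inner.inner ℝ (gradient (S.f z.1) x - gradient (S.f z.1) y) (z.2.col j) *
          Inner.inner ℝ (gradient (S.f z.1) x - gradient (S.f z.1) y) (z.2.col j))
          + 2 * (S.L * β) ^ 2) := by
  rw [stochGrad_val, stochGrad_val, ← smul_sub, ← Finset.sum_sub_distrib, norm_smul, mul_pow,
    Real.norm_eq_abs, sq_abs]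
  simp_rw [← sub_smul]
  rw [Orth.norm_sum_smul_col_sq]
  gcongr with j _
  have h (y : Vec S.d) := abs_le.1 (abs_difference_quotient_sub_le (hS.differentiable z.1)
    (hS.smooth z.1) hβ y (Orth.norm_col z.2 j))
  obtain ⟨h1, h2⟩ := h x
  obtain ⟨h3, h4⟩ := h y
  rw [inner_sub_left]
  set p := (S.f z.1 (x + β • z.2.col j) - S.f z.1 x) / β
  set q := (S.f z.1 (y + β • z.2.col j) - S.f z.1 y) / β
  set p' : ℝ := Inner.inner ℝ (gradient (S.f z.1) x) (z.2.col j)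
  set q' : ℝ := Inner.inner ℝ (gradient (S.f z.1) y) (z.2.col j)
  have h5 : ((p - p') - (q - q')) ^ 2 ≤ (S.L * β) ^ 2 := sq_le_sq' (by linarith) (by linarith)
  nlinarith [sq_nonneg ((p' - q') - ((p - p') - (q - q')))]

/-- The second moment of a difference of structured finite-difference surrogates. -/
theorem integral_norm_stochGrad_sub_sq_le {β : ℝ} (hβ : 0 < β) (x y : Vec S.d) :
    ∫ z, ‖(S.stochGrad β z x).val - (S.stochGrad β z y).val‖ ^ 2 ∂S.sampleLaw
      ≤ 2 * (S.d / S.l) * S.L ^ 2 * ‖x - y‖ ^ 2 + 2 * (S.d ^ 2 / S.l) * (S.L * β) ^ 2 := by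
  have := hS.isProbabilityMeasure_sampleLaw
  have hd := hS.d_pos'
  have hl := hS.l_pos'
  have hn : (0 : ℝ) < S.n := by exact_mod_cast hS.n_pos
  have hc := hS.continuous_stochGrad_left β
  have hcx := hc x
  have hcy := hc y
  have hi (j : Fin S.d) : Integrable (fun z : Fin S.n × Orth S.d =>
      2 * (Inner.inner ℝ (gradient (S.f z.1) x - gradient (S.f z.1) y) (z.2.col j) *
          Inner.inner ℝ (gradient (S.f z.1) x - gradient (S.f z.1) y) (z.2.col j))
          + 2 * (S.L * β) ^ 2) S.sampleLaw := by
    refine integrable_of_continuous_of_compactSpace ?_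
    rw [continuous_prod_of_discrete_left]
    intro i
    have := Orth.continuous_col j
    dsimp only
    fun_prop
  refine (integral_mono (integrable_of_continuous_of_compactSpace (by fun_prop))
    ((integrable_finsetSum _ fun j _ => hi j).const_mul _)
    (fun z => hS.norm_stochGrad_sub_sq_le hβ z x y)).trans ?_
  rw [integral_const_mul, integral_finsetSum _ fun j _ => hi j]
  -- Isotropy supplies the division by `d`; without it the coefficient of `‖x - y‖²` would be `d²/ℓ`
  -- rather than `d/ℓ`.
  have hj (j : Fin S.d) : ∫ z : Fin S.n × Orth S.d,
      (2 * (Inner.inner ℝ (gradient (S.f z.1) x - gradient (S.f z.1) y) (z.2.col j) *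
          Inner.inner ℝ (gradient (S.f z.1) x - gradient (S.f z.1) y) (z.2.col j))
          + 2 * (S.L * β) ^ 2) ∂S.sampleLaw
        ≤ 2 * (S.L ^ 2 * ‖x - y‖ ^ 2 / S.d) + 2 * (S.L * β) ^ 2 := by
    rw [integral_add, integral_const_mul, hS.integral_inner_col_mul_sampleLaw
      (fun i => gradient (S.f i) x - gradient (S.f i) y)
      (fun i => gradient (S.f i) x - gradient (S.f i) y)]
    · simp only [integral_const, probReal_univ, one_smul]
      gcongr
      rw [← Finset.sum_div, ← mul_div_assoc]
      refine div_le_div_of_nonneg_right ?_ hd.le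
      have hs : ∑ i : Fin S.n, Inner.inner ℝ (gradient (S.f i) x - gradient (S.f i) y)
          (gradient (S.f i) x - gradient (S.f i) y)
          ≤ ∑ _i : Fin S.n, S.L ^ 2 * ‖x - y‖ ^ 2 := by
        gcongr with i _
        rw [real_inner_self_eq_norm_sq, ← mul_pow]
        gcongr
        exact hS.smooth i x y
      rw [Finset.sum_const, Finset.card_univ, Fintype.card_fin, nsmul_eq_mul] at hs
      rw [one_div, inv_mul_le_iff₀ hn]
      exact hs
    · refine integrable_of_continuous_of_compactSpace ?_
      rw [continuous_prod_of_discrete_left]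
      intro i
      have := Orth.continuous_col j
      dsimp only
      fun_prop
    · exact integrable_const _
  calc ((S.d : ℝ) / S.l) ^ 2 * _
      ≤ ((S.d : ℝ) / S.l) ^ 2 *
          (S.l • (2 * (S.L ^ 2 * ‖x - y‖ ^ 2 / S.d) + 2 * (S.L * β) ^ 2)) := by
        gcongr
        conv_rhs => rw [← card_filter_lt hS.l_le]
        exact Finset.sum_le_card_nsmul _ _ _ fun j _ => hj j
    _ = _ := by
        rw [nsmul_eq_mul]
        field_simp

theorem C₃_pos : 0 < S.C₃ := by
  have hd := hS.d_pos'
  have hL := hS.L_pos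
  have : 0 < S.A := by
    unfold A
    positivity
  unfold C₃
  positivity

/-- `C₃` carries `12 d²/(ℓb) + 8d + 12 d²` in front of `L²`, whereas variance and squared bias need
only `2 d²/(ℓb)` and `9/4 d²`. -/
theorem error_le_C₃ (β : ℝ) :
    1 / S.b * (2 * ((S.d : ℝ) ^ 2 / S.l) * (S.L * β) ^ 2) + (3 * (S.d * (S.L * β / 2))) ^ 2
      ≤ S.C₃ * β ^ 2 := by
  have hd := hS.d_pos'
  have hl := hS.l_pos'
  have hb : (0 : ℝ) < S.b := by exact_mod_cast hS.b_pos
  have e : S.C₃ * β ^ 2 - (1 / S.b * (2 * ((S.d : ℝ) ^ 2 / S.l) * (S.L * β) ^ 2)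
      + (3 * (S.d * (S.L * β / 2))) ^ 2)
      = (10 * (S.d ^ 2 / (S.l * S.b)) + 8 * S.d + (39 / 4) * S.d ^ 2) * (S.L * β) ^ 2 := by
    unfold C₃ A
    field_simp
    ring
  have : 0 ≤ (10 * ((S.d : ℝ) ^ 2 / (S.l * S.b)) + 8 * S.d + (39 / 4) * S.d ^ 2) *
    (S.L * β) ^ 2 := by positivity
  linarith

/-- The mean square error of the search direction as an estimator of the gradient. -/
theorem integral_norm_direction_sub_sq_le {β : ℝ} (hβ : 0 < β) (x₀ x : Vec S.d) :
    ∫ z, ‖(S.direction β (S.fullGrad β x₀).val x₀ x z).val - gradient S.avg x‖ ^ 2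
      ∂(Measure.pi fun _ : Fin S.b => S.sampleLaw)
      ≤ 2 * (S.d / (S.l * S.b)) * S.L ^ 2 * ‖x - x₀‖ ^ 2 + S.C₃ * β ^ 2 := by
  have := hS.isProbabilityMeasure_sampleLaw
  have hb : (0 : ℝ) < S.b := by exact_mod_cast hS.b_pos
  have hl := hS.l_pos'
  have hcx := hS.continuous_stochGrad_left β x
  have hcx₀ := hS.continuous_stochGrad_left β x₀
  have h := integral_norm_sq_average_add_le (μ := S.sampleLaw) hS.b_pos
    (memLp_two_of_continuous_of_compactSpace (hcx.sub hcx₀))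
    ((S.fullGrad β x₀).val - gradient S.avg x)
  simp only [Pi.sub_apply, direction_val, add_sub_assoc] at h ⊢
  refine h.trans ?_
  -- Inserting `∇f(x₀)` leaves three biases: the structured surrogate at `x` and at `x₀`, and the
  -- full surrogate at `x₀`.
  have h1 : ‖∫ z, ((S.stochGrad β z x).val - (S.stochGrad β z x₀).val) ∂S.sampleLaw +
      ((S.fullGrad β x₀).val - gradient S.avg x)‖ ≤ 3 * (S.d * (S.L * β / 2)) := by
    rw [integral_sub (integrable_of_continuous_of_compactSpace hcx)
      (integrable_of_continuous_of_compactSpace hcx₀)]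
    have h2 := hS.norm_integral_stochGrad_sub_le hβ x
    have h3 := hS.norm_integral_stochGrad_sub_le hβ x₀
    have h4 := hS.norm_fullGrad_sub_le hβ x₀
    have e : ∀ a b c g g₀ : Vec S.d, a - b + (c - g) = ((a - g) - (b - g₀)) + (c - g₀) := by
      intros; abel
    rw [e _ _ _ _ (gradient S.avg x₀)]
    have h6 := norm_sub_le (∫ z, (S.stochGrad β z x).val ∂S.sampleLaw - gradient S.avg x)
      (∫ z, (S.stochGrad β z x₀).val ∂S.sampleLaw - gradient S.avg x₀)
    exact (norm_add_le _ _).trans (by linarith)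
  have h5 := hS.integral_norm_stochGrad_sub_sq_le hβ x x₀
  calc _ ≤ 1 / (S.b : ℝ) * (2 * (S.d / S.l) * S.L ^ 2 * ‖x - x₀‖ ^ 2 +
        2 * (S.d ^ 2 / S.l) * (S.L * β) ^ 2) + (3 * (S.d * (S.L * β / 2))) ^ 2 := by
        gcongr
    _ = 2 * (S.d / (S.l * S.b)) * S.L ^ 2 * ‖x - x₀‖ ^ 2 +
        (1 / S.b * (2 * ((S.d : ℝ) ^ 2 / S.l) * (S.L * β) ^ 2) +
          (3 * (S.d * (S.L * β / 2))) ^ 2) := by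
        field_simp
        ring
    _ ≤ _ := by
        gcongr
        exact hS.error_le_C₃ β

end Valid

end Setting

end VRSZD
end

/-! ### The iterates as random variables: boundedness, measurability, independence -/

noncomputable section

namespace VRSZD

namespace Setting

variable {S : Setting.{u}}

/-- One inner iteration, as a function of the outer iterate, the inner iterate and the batch. -/
def step (S : Setting.{u}) (β : ℝ) (x₀ x : Vec S.d) (z : Fin S.b → Fin S.n × Orth S.d) :
    Vec S.d :=
  S.prox S.γ (x - S.γ • (S.direction β (S.fullGrad β x₀).val x₀ x z).val)

/-- The batch drawn in inner iteration `k` of outer iteration `τ`. -/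
def batch (S : Setting.{u}) (τ k : ℕ) (ω : S.Ω) : Fin S.b → Fin S.n × Orth S.d :=
  fun j => S.sample τ k j ω

/-- The sigma-algebra generated by the samples drawn before inner iteration `k` of outer
iteration `τ`. -/
abbrev past (S : Setting.{u}) (τ k : ℕ) : MeasurableSpace S.Ω :=
  ⨆ p ∈ {p : ℕ × Fin S.m × Fin S.b | p.1 < τ ∨ p.1 = τ ∧ (p.2.1 : ℕ) < k},
    MeasurableSpace.comap (S.sample p.1 p.2.1 p.2.2) inferInstance

theorem past_mono {τ τ' k k' : ℕ} (h : ∀ p : ℕ × Fin S.m × Fin S.b,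
    (p.1 < τ ∨ p.1 = τ ∧ (p.2.1 : ℕ) < k) → (p.1 < τ' ∨ p.1 = τ' ∧ (p.2.1 : ℕ) < k')) :
    S.past τ k ≤ S.past τ' k' :=
  biSup_mono h

theorem iter_zero_zero (β : ℕ → ℝ) (ω : S.Ω) : S.iter β 0 0 ω = S.start := rfl

theorem iter_succ_zero (β : ℕ → ℝ) (τ : ℕ) (ω : S.Ω) :
    S.iter β (τ + 1) 0 ω = S.iter β τ S.m ω := rfl

theorem iter_succ (β : ℕ → ℝ) (τ k : ℕ) (ω : S.Ω) : S.iter β τ (k + 1) ω =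
    S.step (β τ) (S.iter β τ 0 ω) (S.iter β τ k ω) (S.batch τ k ω) := rfl

/-- Induction along the iterates of the algorithm. -/
theorem iter_induction {m : ℕ} {Q : ℕ → ℕ → Prop} (h0 : Q 0 0)
    (hstep : ∀ τ k, k < m → Q τ 0 → Q τ k → Q τ (k + 1))
    (hnext : ∀ τ, Q τ m → Q (τ + 1) 0) : ∀ τ k, k ≤ m → Q τ k := by
  have h (τ : ℕ) (hτ : Q τ 0) : ∀ k ≤ m, Q τ k := by
    intro k
    induction k with
    | zero => exact fun _ => hτ
    | succ k ih => exact fun hk => hstep τ k hk hτ (ih (Nat.le_of_succ_le hk))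
  intro τ
  induction τ with
  | zero => exact h 0 h0
  | succ τ ih => exact h _ (hnext τ (ih m le_rfl))

namespace Valid

variable (hS : S.Valid)

include hS

theorem isProx_prox {γ : ℝ} (hγ : 0 < γ) (x : Vec S.d) : S.IsProx γ x (S.prox γ x) :=
  Classical.epsilon_spec (hS.proximable γ hγ x)

theorem prox_mem {γ : ℝ} (hγ : 0 < γ) (x : Vec S.d) : S.prox γ x ∈ S.dom :=
  (hS.isProx_prox hγ x).1

theorem prox_variational {γ : ℝ} (hγ : 0 < γ) (x : Vec S.d) : ∀ w ∈ S.dom,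
    S.h (S.prox γ x) + 1 / γ * Inner.inner ℝ (x - S.prox γ x) (w - S.prox γ x) ≤ S.h w :=
  fun _ hw => _root_.prox_variational hS.convex hγ (hS.prox_mem hγ x) (hS.isProx_prox hγ x).2 hw

/-- By nonexpansiveness. Continuity of the whole step yields both measurability and boundedness of
the iterates. -/
theorem continuous_prox {γ : ℝ} (hγ : 0 < γ) : Continuous (S.prox γ) :=
  (LipschitzWith.of_dist_le_mul (K := 1) fun x y => by
    rw [dist_eq_norm, dist_eq_norm, NNReal.coe_one, one_mul]
    exact norm_sub_le_of_prox_variational hγ (hS.prox_mem hγ x) (hS.prox_mem hγ y)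
      (hS.prox_variational hγ x) (hS.prox_variational hγ y)).continuous

theorem γ_pos : 0 < S.γ := by
  have hd := hS.d_pos'
  have hl := hS.l_pos'
  have hL := hS.L_pos
  have hb : (0 : ℝ) < S.b := by exact_mod_cast hS.b_pos
  have hm : (0 : ℝ) < S.m := by exact_mod_cast hS.m_pos
  unfold γ
  positivity

theorem continuous_gradMap : Continuous (S.gradMap S.γ) := by
  have h1 := hS.continuous_prox hS.γ_pos
  have h2 := hS.continuous_gradient_avg
  unfold gradMap
  fun_prop

theorem continuous_direction (β : ℝ) :
    Continuous fun p : (Vec S.d × Vec S.d) × (Fin S.b → Fin S.n × Orth S.d) =>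
      (S.direction β (S.fullGrad β p.1.1).val p.1.1 p.1.2 p.2).val := by
  have h1 := hS.continuous_fullGrad β
  have h2 {v : (Vec S.d × Vec S.d) × (Fin S.b → Fin S.n × Orth S.d) → Vec S.d}
      (hv : Continuous v) (j : Fin S.b) : Continuous fun p => (S.stochGrad β (p.2 j) (v p)).val :=
    Continuous.comp (g := fun p : (Fin S.n × Orth S.d) × Vec S.d => (S.stochGrad β p.1 p.2).val)
      (f := fun p : (Vec S.d × Vec S.d) × (Fin S.b → Fin S.n × Orth S.d) => (p.2 j, v p))
      (hS.continuous_stochGrad β) (((continuous_apply j).comp continuous_snd).prodMk hv)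
  simp only [direction_val]
  have h3 (j : Fin S.b) := (h2 (continuous_snd.comp continuous_fst) j).sub
    (h2 (continuous_fst.comp continuous_fst) j)
  exact ((continuous_finsetSum _ fun j _ => h3 j).const_smul (1 / (S.b : ℝ))).add
    (h1.comp (continuous_fst.comp continuous_fst))

theorem continuous_step (β : ℝ) :
    Continuous fun p : (Vec S.d × Vec S.d) × (Fin S.b → Fin S.n × Orth S.d) =>
      S.step β p.1.1 p.1.2 p.2 := by
  have h1 := hS.continuous_prox hS.γ_pos
  have h2 := hS.continuous_direction β
  unfold step
  fun_prop

theorem measurable_step (β : ℝ) :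
    Measurable fun p : (Vec S.d × Vec S.d) × (Fin S.b → Fin S.n × Orth S.d) =>
      S.step β p.1.1 p.1.2 p.2 :=
  (hS.continuous_step β).measurable

theorem iter_mem (β : ℕ → ℝ) (τ k : ℕ) (hk : k ≤ S.m) (ω : S.Ω) : S.iter β τ k ω ∈ S.dom := by
  refine iter_induction (m := S.m) (Q := fun τ k => S.iter β τ k ω ∈ S.dom) hS.start_mem
    (fun τ k _ _ _ => ?_) (fun τ h => h) τ k hk
  exact hS.prox_mem hS.γ_pos _

/-- The samples range over a compact space and the step is continuous, so compact sets are mapped to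
compact sets. All later integrability rests on this. -/
theorem exists_isCompact_iter_mem (β : ℕ → ℝ) (τ k : ℕ) (hk : k ≤ S.m) :
    ∃ K : Set (Vec S.d), IsCompact K ∧ ∀ ω, S.iter β τ k ω ∈ K := by
  refine iter_induction (m := S.m)
    (Q := fun τ k => ∃ K : Set (Vec S.d), IsCompact K ∧ ∀ ω, S.iter β τ k ω ∈ K)
    ⟨{S.start}, isCompact_singleton, fun ω => rfl⟩ ?_ (fun τ h => h) τ k hk
  rintro τ k - ⟨K₀, hK₀, h₀⟩ ⟨K, hK, h⟩
  refine ⟨_, ((hK₀.prod hK).prod isCompact_univ).image (hS.continuous_step (β τ)), fun ω => ?_⟩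
  exact ⟨((S.iter β τ 0 ω, S.iter β τ k ω), S.batch τ k ω), ⟨⟨h₀ ω, h ω⟩, trivial⟩,
    (iter_succ β τ k ω).symm⟩

omit hS in
theorem measurable_sample_past (τ : ℕ) {k k' : ℕ} (hk : k < S.m) (hkk : k < k') (j : Fin S.b) :
    Measurable[S.past τ k'] (S.sample τ k j) := by
  refine Measurable.mono (comap_measurable _) ?_ le_rfl
  exact le_biSup (fun p : ℕ × Fin S.m × Fin S.b =>
    MeasurableSpace.comap (S.sample p.1 p.2.1 p.2.2) inferInstance)
    (i := (τ, ⟨k, hk⟩, j)) (Or.inr ⟨rfl, hkk⟩)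

theorem measurable_iter_past (β : ℕ → ℝ) (τ k : ℕ) (hk : k ≤ S.m) :
    Measurable[S.past τ k] (S.iter β τ k) := by
  refine iter_induction (m := S.m) (Q := fun τ k => Measurable[S.past τ k] (S.iter β τ k))
    (@measurable_const _ _ _ (S.past 0 0) S.start) ?_ ?_ τ k hk
  · intro τ k hk h0 h
    have h0' : Measurable[S.past τ (k + 1)] (S.iter β τ 0) :=
      h0.mono (past_mono fun p hp => by omega) le_rfl
    have h' : Measurable[S.past τ (k + 1)] (S.iter β τ k) :=
      h.mono (past_mono fun p hp => by omega) le_rfl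
    have hb : Measurable[S.past τ (k + 1)] (S.batch τ k) :=
      @measurable_pi_lambda _ _ _ (S.past τ (k + 1)) _ _ fun j =>
        measurable_sample_past τ hk (Nat.lt_succ_self k) j
    have hp : Measurable[S.past τ (k + 1)] fun ω =>
        ((S.iter β τ 0 ω, S.iter β τ k ω), S.batch τ k ω) := (h0'.prodMk h').prodMk hb
    have hq := (hS.measurable_step (β τ)).comp hp
    have e : S.iter β τ (k + 1) = fun ω =>
        S.step (β τ) (S.iter β τ 0 ω) (S.iter β τ k ω) (S.batch τ k ω) :=
      funext (iter_succ β τ k)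
    rw [e]
    simp only [Function.comp_def] at hq
    exact hq
  · intro τ h
    -- Inner indices are below `m`, so everything before `(τ, m)` lies in outer iterations before `τ
    -- + 1`.
    exact h.mono (past_mono fun p hp => by have := p.2.1.2; omega) le_rfl

theorem past_le (τ k : ℕ) : S.past τ k ≤ S.mΩ :=
  iSup₂_le fun p _ => (hS.measurable p.1 p.2.1 p.2.2).comap_le

theorem measurable_iter (β : ℕ → ℝ) (τ k : ℕ) (hk : k ≤ S.m) : Measurable (S.iter β τ k) :=
  (hS.measurable_iter_past β τ k hk).mono (hS.past_le τ k) le_rfl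

theorem measurable_batch (τ k : ℕ) (hk : k < S.m) : Measurable (S.batch τ k) :=
  measurable_pi_lambda _ fun j => hS.measurable τ ⟨k, hk⟩ j

theorem map_batch (τ k : ℕ) (hk : k < S.m) :
    S.P.map (S.batch τ k) = Measure.pi fun _ => S.sampleLaw := by
  have := hS.prob
  have h := hS.indep.precomp (g := fun j : Fin S.b => (τ, (⟨k, hk⟩ : Fin S.m), j))
    (fun i j hij => by simpa using hij)
  have h2 := iIndepFun.map_fun_eq_pi_map
    (fun j => (hS.measurable τ ⟨k, hk⟩ j).aemeasurable) h
  refine h2.trans ?_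
  congr 1
  ext1 j
  exact hS.law τ ⟨k, hk⟩ j

/-- The batch is independent of the iterates computed before it is drawn. -/
theorem indepFun_iter_batch (β : ℕ → ℝ) (τ k : ℕ) (hk : k < S.m) :
    IndepFun (fun ω => (S.iter β τ 0 ω, S.iter β τ k ω)) (S.batch τ k) S.P := by
  -- Past and current batch are generated by disjoint sets of independent samples.
  have h := indep_iSup_of_disjoint
    (m := fun p : ℕ × Fin S.m × Fin S.b =>
      MeasurableSpace.comap (S.sample p.1 p.2.1 p.2.2) inferInstance)
    (fun p => (hS.measurable p.1 p.2.1 p.2.2).comap_le) hS.indep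
    (S := {p | p.1 < τ ∨ p.1 = τ ∧ (p.2.1 : ℕ) < k})
    (T := {p | p.1 = τ ∧ (p.2.1 : ℕ) = k})
    (Set.disjoint_left.2 fun p hp hp' => by
      simp only [Set.mem_ofPred_eq] at hp hp'
      omega)
  rw [IndepFun_iff_Indep]
  refine indep_of_indep_of_le_left (indep_of_indep_of_le_right h ?_) ?_
  · refine MeasurableSpace.comap_le_iff_le_map.2 ?_
    have hj (j : Fin S.b) := le_biSup (fun p : ℕ × Fin S.m × Fin S.b =>
      MeasurableSpace.comap (S.sample p.1 p.2.1 p.2.2) inferInstance)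
      (s := {p | p.1 = τ ∧ (p.2.1 : ℕ) = k}) (i := (τ, ⟨k, hk⟩, j)) ⟨rfl, rfl⟩
    refine Measurable.le_map (m₁ := ⨆ p ∈ {p : ℕ × Fin S.m × Fin S.b | p.1 = τ ∧ (p.2.1 : ℕ) = k},
      MeasurableSpace.comap (S.sample p.1 p.2.1 p.2.2) inferInstance) ?_
    exact @measurable_pi_lambda _ _ _ (_) _ _ fun j =>
      (comap_measurable (S.sample τ k j)).mono (hj j) le_rfl
  · refine Measurable.comap_le (m₁ := S.past τ k) (Measurable.prodMk ?_ ?_)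
    · exact (hS.measurable_iter_past β τ 0 (Nat.zero_le _)).mono
        (past_mono fun p hp => by omega) le_rfl
    · exact hS.measurable_iter_past β τ k hk.le

/-- Continuous functions of the iterates and the current batch are integrable. -/
theorem integrable_comp_iter_batch (β : ℕ → ℝ) (τ k : ℕ) (hk : k < S.m)
    {φ : (Vec S.d × Vec S.d) × (Fin S.b → Fin S.n × Orth S.d) → ℝ} (hφ : Continuous φ) :
    Integrable (fun ω => φ ((S.iter β τ 0 ω, S.iter β τ k ω), S.batch τ k ω)) S.P := by
  have := hS.prob
  obtain ⟨K₀, hK₀, h₀⟩ := hS.exists_isCompact_iter_mem β τ 0 (Nat.zero_le _)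
  obtain ⟨K, hK, h⟩ := hS.exists_isCompact_iter_mem β τ k hk.le
  obtain ⟨C, hC⟩ := ((hK₀.prod hK).prod isCompact_univ).exists_bound_of_continuousOn
    hφ.continuousOn
  refine Integrable.of_bound (hφ.measurable.comp ((((hS.measurable_iter β τ 0
    (Nat.zero_le _)).prodMk (hS.measurable_iter β τ k hk.le)).prodMk
    (hS.measurable_batch τ k hk)))).aestronglyMeasurable C
    (Filter.Eventually.of_forall fun ω => hC _ ⟨⟨h₀ ω, h ω⟩, trivial⟩)

/-- Conditioning on the iterates computed before the current batch is drawn. -/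
theorem integral_comp_iter_batch_le (β : ℕ → ℝ) (τ k : ℕ) (hk : k < S.m)
    {φ : (Vec S.d × Vec S.d) × (Fin S.b → Fin S.n × Orth S.d) → ℝ} (hφ : Continuous φ)
    {ψ : Vec S.d × Vec S.d → ℝ} (hψ : Continuous ψ)
    (h : ∀ x, ∫ z, φ (x, z) ∂(Measure.pi fun _ => S.sampleLaw) ≤ ψ x) :
    ∫ ω, φ ((S.iter β τ 0 ω, S.iter β τ k ω), S.batch τ k ω) ∂S.P
      ≤ ∫ ω, ψ (S.iter β τ 0 ω, S.iter β τ k ω) ∂S.P := by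
  have := hS.prob
  have := hS.isProbabilityMeasure_sampleLaw
  have hX : Measurable fun ω => (S.iter β τ 0 ω, S.iter β τ k ω) :=
    (hS.measurable_iter β τ 0 (Nat.zero_le _)).prodMk (hS.measurable_iter β τ k hk.le)
  have hZ := hS.measurable_batch τ k hk
  -- The joint law is a product, so Fubini plays the role of conditional expectation.
  have hprod := (indepFun_iff_map_prod_eq_prod_map_map hX.aemeasurable hZ.aemeasurable).1
    (hS.indepFun_iter_batch β τ k hk)
  rw [hS.map_batch τ k hk] at hprod
  have : IsProbabilityMeasure (S.P.map fun ω => (S.iter β τ 0 ω, S.iter β τ k ω)) :=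
    Measure.isProbabilityMeasure_map hX.aemeasurable
  have hi : Integrable φ ((S.P.map fun ω => (S.iter β τ 0 ω, S.iter β τ k ω)).prod
      (Measure.pi fun _ => S.sampleLaw)) := by
    rw [← hprod, integrable_map_measure hφ.aestronglyMeasurable (hX.prodMk hZ).aemeasurable]
    exact hS.integrable_comp_iter_batch β τ k hk hφ
  have hi' : Integrable ψ (S.P.map fun ω => (S.iter β τ 0 ω, S.iter β τ k ω)) := by
    rw [integrable_map_measure hψ.aestronglyMeasurable hX.aemeasurable]
    exact hS.integrable_comp_iter_batch β τ k hk (φ := fun p => ψ p.1) (by fun_prop)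
  calc ∫ ω, φ ((S.iter β τ 0 ω, S.iter β τ k ω), S.batch τ k ω) ∂S.P
      = ∫ p, φ p ∂((S.P.map fun ω => (S.iter β τ 0 ω, S.iter β τ k ω)).prod
        (Measure.pi fun _ => S.sampleLaw)) := by
        rw [← hprod, integral_map (hX.prodMk hZ).aemeasurable hφ.aestronglyMeasurable]
    _ = ∫ x, ∫ z, φ (x, z) ∂(Measure.pi fun _ => S.sampleLaw)
        ∂(S.P.map fun ω => (S.iter β τ 0 ω, S.iter β τ k ω)) := integral_prod _ hi
    _ ≤ ∫ x, ψ x ∂(S.P.map fun ω => (S.iter β τ 0 ω, S.iter β τ k ω)) :=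
        integral_mono hi.integral_prod_left hi' h
    _ = _ := integral_map hX.aemeasurable hψ.aestronglyMeasurable

end Valid

end Setting

end VRSZD
end

/-! ### Descent along a run and the convergence estimate -/

noncomputable section

namespace VRSZD

/-- The squared distance from the starting point of a path is controlled by the squares of its
steps. -/
theorem sum_norm_sub_sq_le {E : Type*} [SeminormedAddCommGroup E] (x : ℕ → E) (m : ℕ) :
    ∑ k ∈ Finset.range m, ‖x k - x 0‖ ^ 2
      ≤ (m : ℝ) ^ 2 * ∑ k ∈ Finset.range m, ‖x (k + 1) - x k‖ ^ 2 := by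
  -- Cauchy-Schwarz on the telescoped path costs one factor `m`; summation over `k` costs the other.
  have h : ∀ k ∈ Finset.range m, ‖x k - x 0‖ ^ 2
      ≤ (m : ℝ) * ∑ k ∈ Finset.range m, ‖x (k + 1) - x k‖ ^ 2 := by
    intro k hk
    have hk := (Finset.mem_range.1 hk).le
    rw [← Finset.sum_range_sub]
    calc ‖∑ j ∈ Finset.range k, (x (j + 1) - x j)‖ ^ 2
        ≤ (∑ j ∈ Finset.range k, ‖x (j + 1) - x j‖) ^ 2 := by
          gcongr
          exact norm_sum_le _ _
      _ ≤ (Finset.range k).card * ∑ j ∈ Finset.range k, ‖x (j + 1) - x j‖ ^ 2 :=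
          sq_sum_le_card_mul_sum_sq
      _ ≤ _ := by
          rw [Finset.card_range]
          gcongr
  refine (Finset.sum_le_card_nsmul _ _ _ h).trans_eq ?_
  rw [Finset.card_range, nsmul_eq_mul]
  ring

namespace Setting

variable {S : Setting.{u}}

/-- The squared error of the search direction. -/
def dirError (S : Setting.{u}) (β : ℕ → ℝ) (τ k : ℕ) (ω : S.Ω) : ℝ :=
  ‖(S.direction (β τ) (S.fullGrad (β τ) (S.iter β τ 0 ω)).val (S.iter β τ 0 ω) (S.iter β τ k ω)
    (S.batch τ k ω)).val - gradient S.avg (S.iter β τ k ω)‖ ^ 2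

namespace Valid

variable (hS : S.Valid)

include hS

theorem b_pos' : (0 : ℝ) < S.b := by exact_mod_cast hS.b_pos

theorem m_pos' : (0 : ℝ) < S.m := by exact_mod_cast hS.m_pos

/-- From `√b ≤ m` and `ℓ ≤ d`, which give `√(ℓb) ≤ m√d`. -/
theorem L_mul_γ_le : S.L * S.γ ≤ 1 / 10 := by
  have hd := hS.d_pos'
  have hL := hS.L_pos
  have hm := hS.m_pos'
  have h1 : Real.sqrt (S.l * S.b) ≤ S.m * Real.sqrt S.d := by
    rw [Real.sqrt_mul (Nat.cast_nonneg _), mul_comm]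
    have : (S.l : ℝ) ≤ S.d := by exact_mod_cast hS.l_le
    have := hS.sqrt_b_le
    gcongr
  have h2 : 0 < Real.sqrt S.d := Real.sqrt_pos.2 hd
  unfold γ
  rw [← mul_div_assoc, div_le_iff₀ (by positivity)]
  nlinarith

/-- The calibration of the step size: the accumulated drift becomes a small fixed fraction of the
step-length gain. -/
theorem γ_sq : S.γ ^ 2 * (S.d / (S.l * S.b) * S.L ^ 2 * S.m ^ 2) = 1 / 100 := by
  have hd := hS.d_pos'
  have hL := hS.L_pos
  have hm := hS.m_pos'
  have hl := hS.l_pos'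
  have hb := hS.b_pos'
  unfold γ
  rw [div_pow, mul_pow, Real.sq_sqrt (by positivity), Real.sq_sqrt (by positivity)]
  field_simp
  norm_num

theorem F_start_ge : S.Fmin ≤ S.F S.start := hS.min.2 ⟨_, hS.start_mem, rfl⟩

theorem F_iter_succ_le (β : ℕ → ℝ) (τ k : ℕ) (hk : k < S.m) (ω : S.Ω) :
    S.F (S.iter β τ (k + 1) ω) ≤ S.F (S.iter β τ k ω) + S.γ / 2 * S.dirError β τ k ω
      - (1 / (2 * S.γ) - S.L / 2) * ‖S.iter β τ (k + 1) ω - S.iter β τ k ω‖ ^ 2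
      - S.γ / 2 * ‖S.gradMap S.γ (S.iter β τ k ω)‖ ^ 2 := by
  have hγ := hS.γ_pos
  set x := S.iter β τ k ω with hx
  set y := S.iter β τ (k + 1) ω with hy
  have hT := (abs_le.1 (abs_sub_sub_inner_gradient_le hS.differentiable_avg hS.smooth_avg x
    (y - x))).2
  rw [add_sub_cancel] at hT
  have h := prox_step_decrease (f := S.avg) (h := S.h) (L := S.L) (y := y) (g := gradient S.avg x)
    (v := (S.direction (β τ) (S.fullGrad (β τ) (S.iter β τ 0 ω)).val (S.iter β τ 0 ω) x
      (S.batch τ k ω)).val)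
    hγ (hS.iter_mem β τ k hk.le ω) (hS.prox_mem hγ (x - S.γ • gradient S.avg x))
    (by linarith) (hS.prox_variational hγ _) (hS.prox_variational hγ _)
  have e : S.γ / 2 * ‖S.gradMap S.γ x‖ ^ 2
      = 1 / (2 * S.γ) * ‖x - S.prox S.γ (x - S.γ • gradient S.avg x)‖ ^ 2 := by
    rw [gradMap, norm_smul, mul_pow, Real.norm_of_nonneg (by positivity)]
    field_simp
  rw [e]
  exact h

/-- The descent of the objective along a whole run, before taking expectations. -/
theorem sum_gradMap_le (β : ℕ → ℝ) (T : ℕ) (ω : S.Ω) :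
    ∑ τ ∈ Finset.range (T + 1), ∑ k ∈ Finset.range S.m,
      (‖S.gradMap S.γ (S.iter β τ k ω)‖ ^ 2 + 2 * (S.d / (S.l * S.b)) * S.L ^ 2 *
        ‖S.iter β τ k ω - S.iter β τ 0 ω‖ ^ 2 - S.dirError β τ k ω)
      ≤ 2 / S.γ * (S.F S.start - S.Fmin) := by
  have hγ := hS.γ_pos
  have hd := hS.d_pos'
  have hl := hS.l_pos'
  have hb := hS.b_pos'
  have hm := hS.m_pos'
  have hκ : S.γ ^ 2 * (S.d / (S.l * S.b) * S.L ^ 2 * S.m ^ 2) ≤ 1 / 2 - S.L * S.γ / 2 := by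
    rw [hS.γ_sq]
    linarith [hS.L_mul_γ_le]
  have hκ' : 2 * (S.d / (S.l * S.b)) * S.L ^ 2 * (S.m : ℝ) ^ 2
      ≤ 2 / S.γ * (1 / (2 * S.γ) - S.L / 2) := by
    rw [show 2 / S.γ * (1 / (2 * S.γ) - S.L / 2) = 2 * (1 / 2 - S.L * S.γ / 2) / S.γ ^ 2 by
      field_simp, le_div_iff₀ (by positivity)]
    linarith
  have hout (τ : ℕ) : ∑ k ∈ Finset.range S.m,
      (‖S.gradMap S.γ (S.iter β τ k ω)‖ ^ 2 + 2 * (S.d / (S.l * S.b)) * S.L ^ 2 *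
        ‖S.iter β τ k ω - S.iter β τ 0 ω‖ ^ 2 - S.dirError β τ k ω)
      ≤ 2 / S.γ * (S.F (S.iter β τ 0 ω) - S.F (S.iter β (τ + 1) 0 ω)) := by
    -- Scaling the one-step descent by `2/γ` gives the gradient mapping and the error coefficient
    -- one.
    have h1 : ∀ k ∈ Finset.range S.m, ‖S.gradMap S.γ (S.iter β τ k ω)‖ ^ 2 +
        2 / S.γ * (1 / (2 * S.γ) - S.L / 2) * ‖S.iter β τ (k + 1) ω - S.iter β τ k ω‖ ^ 2
        - S.dirError β τ k ω
        ≤ 2 / S.γ * (S.F (S.iter β τ k ω) - S.F (S.iter β τ (k + 1) ω)) := by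
      intro k hk
      have h := mul_le_mul_of_nonneg_left (hS.F_iter_succ_le β τ k (Finset.mem_range.1 hk) ω)
        (by positivity : 0 ≤ 2 / S.γ)
      have e (a : ℝ) : 2 / S.γ * (S.γ / 2 * a) = a := by field_simp
      simp only [mul_sub, mul_add, e] at h ⊢
      linarith
    have h2 := Finset.sum_le_sum h1
    rw [← Finset.mul_sum, Finset.sum_range_sub', Finset.sum_sub_distrib,
      Finset.sum_add_distrib, ← Finset.mul_sum] at h2
    rw [Finset.sum_sub_distrib, Finset.sum_add_distrib, ← Finset.mul_sum, iter_succ_zero]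
    have h3 := sum_norm_sub_sq_le (fun k => S.iter β τ k ω) S.m
    have h4 := mul_le_mul_of_nonneg_left h3
      (by positivity : 0 ≤ 2 * ((S.d : ℝ) / (S.l * S.b)) * S.L ^ 2)
    have h5 := mul_le_mul_of_nonneg_right hκ' (Finset.sum_nonneg fun k _ =>
      sq_nonneg ‖S.iter β τ (k + 1) ω - S.iter β τ k ω‖ : 0 ≤ ∑ k ∈ Finset.range S.m,
        ‖S.iter β τ (k + 1) ω - S.iter β τ k ω‖ ^ 2)
    linarith
  refine (Finset.sum_le_sum fun τ _ => hout τ).trans ?_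
  rw [← Finset.mul_sum, Finset.sum_range_sub' (fun τ => S.F (S.iter β τ 0 ω)), iter_zero_zero]
  gcongr
  exact hS.min.2 ⟨_, hS.iter_mem β (T + 1) 0 (Nat.zero_le _) ω, rfl⟩

theorem integrable_gradMap (β : ℕ → ℝ) (τ k : ℕ) (hk : k < S.m) :
    Integrable (fun ω => ‖S.gradMap S.γ (S.iter β τ k ω)‖ ^ 2) S.P := by
  have := hS.continuous_gradMap
  exact hS.integrable_comp_iter_batch β τ k hk (φ := fun p => ‖S.gradMap S.γ p.1.2‖ ^ 2)
    (by fun_prop)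

theorem integrable_dist (β : ℕ → ℝ) (τ k : ℕ) (hk : k < S.m) :
    Integrable (fun ω => ‖S.iter β τ k ω - S.iter β τ 0 ω‖ ^ 2) S.P :=
  hS.integrable_comp_iter_batch β τ k hk (φ := fun p => ‖p.1.2 - p.1.1‖ ^ 2) (by fun_prop)

theorem continuous_dirError (β : ℝ) :
    Continuous fun p : (Vec S.d × Vec S.d) × (Fin S.b → Fin S.n × Orth S.d) =>
      ‖(S.direction β (S.fullGrad β p.1.1).val p.1.1 p.1.2 p.2).val - gradient S.avg p.1.2‖ ^ 2 :=
  (((hS.continuous_direction β).sub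
    (hS.continuous_gradient_avg.comp (continuous_snd.comp continuous_fst))).norm).pow 2

theorem integrable_dirError (β : ℕ → ℝ) (τ k : ℕ) (hk : k < S.m) :
    Integrable (S.dirError β τ k) S.P :=
  hS.integrable_comp_iter_batch β τ k hk (hS.continuous_dirError (β τ))

theorem integral_dirError_le {β : ℕ → ℝ} (hβ : ∀ τ, 0 < β τ) (τ k : ℕ) (hk : k < S.m) :
    ∫ ω, S.dirError β τ k ω ∂S.P ≤ 2 * (S.d / (S.l * S.b)) * S.L ^ 2 *
      ∫ ω, ‖S.iter β τ k ω - S.iter β τ 0 ω‖ ^ 2 ∂S.P + S.C₃ * β τ ^ 2 := by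
  have := hS.prob
  refine (hS.integral_comp_iter_batch_le β τ k hk (hS.continuous_dirError (β τ))
    (ψ := fun x => 2 * (S.d / (S.l * S.b)) * S.L ^ 2 * ‖x.2 - x.1‖ ^ 2 + S.C₃ * β τ ^ 2)
    (by fun_prop) (fun x => hS.integral_norm_direction_sub_sq_le (hβ τ) x.1 x.2)).trans_eq ?_
  rw [integral_add ((hS.integrable_dist β τ k hk).const_mul _) (integrable_const _),
    integral_const_mul]
  simp

theorem sum_integral_gradMap_le {β : ℕ → ℝ} (hβ : ∀ τ, 0 < β τ) (T : ℕ) :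
    ∑ τ ∈ Finset.range (T + 1), ∑ k ∈ Finset.range S.m,
      ∫ ω, ‖S.gradMap S.γ (S.iter β τ k ω)‖ ^ 2 ∂S.P
      ≤ 2 / S.γ * (S.F S.start - S.Fmin) +
        S.m * (S.C₃ * ∑ τ ∈ Finset.range (T + 1), β τ ^ 2) := by
  have := hS.prob
  have hi (τ k : ℕ) (hk : k < S.m) : Integrable (fun ω => ‖S.gradMap S.γ (S.iter β τ k ω)‖ ^ 2 +
      2 * (S.d / (S.l * S.b)) * S.L ^ 2 * ‖S.iter β τ k ω - S.iter β τ 0 ω‖ ^ 2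
        - S.dirError β τ k ω) S.P :=
    ((hS.integrable_gradMap β τ k hk).add ((hS.integrable_dist β τ k hk).const_mul _)).sub
      (hS.integrable_dirError β τ k hk)
  have hi' (τ : ℕ) := integrable_finsetSum (Finset.range S.m) fun k hk =>
    hi τ k (Finset.mem_range.1 hk)
  have h := integral_mono (integrable_finsetSum (Finset.range (T + 1)) fun τ _ => hi' τ)
    (integrable_const _) (fun ω => hS.sum_gradMap_le β T ω)
  rw [integral_finsetSum _ fun τ _ => hi' τ, integral_const, probReal_univ, one_smul] at h
  -- In expectation the error is at most the drift term plus `C₃ β_τ²`; the drift cancels.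
  have h2 : ∑ τ ∈ Finset.range (T + 1), ∑ k ∈ Finset.range S.m,
      (∫ ω, ‖S.gradMap S.γ (S.iter β τ k ω)‖ ^ 2 ∂S.P - S.C₃ * β τ ^ 2)
      ≤ 2 / S.γ * (S.F S.start - S.Fmin) := by
    refine le_trans (Finset.sum_le_sum fun τ _ => ?_) h
    rw [integral_finsetSum _ fun k hk => hi τ k (Finset.mem_range.1 hk)]
    refine Finset.sum_le_sum fun k hk => ?_
    have hk := Finset.mem_range.1 hk
    have hadd : Integrable (fun ω => ‖S.gradMap S.γ (S.iter β τ k ω)‖ ^ 2 +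
        2 * (S.d / (S.l * S.b)) * S.L ^ 2 * ‖S.iter β τ k ω - S.iter β τ 0 ω‖ ^ 2) S.P :=
      (hS.integrable_gradMap β τ k hk).add ((hS.integrable_dist β τ k hk).const_mul _)
    rw [integral_sub hadd (hS.integrable_dirError β τ k hk),
      integral_add (hS.integrable_gradMap β τ k hk) ((hS.integrable_dist β τ k hk).const_mul _),
      integral_const_mul]
    linarith [hS.integral_dirError_le hβ τ k hk]
  simp only [Finset.sum_sub_distrib, Finset.sum_const, Finset.card_range, nsmul_eq_mul,
    ← Finset.mul_sum] at h2
  linarith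

/-- The basic convergence estimate. -/
theorem eta_le {β : ℕ → ℝ} (hβ : ∀ τ, 0 < β τ) (T : ℕ) :
    S.eta β T ≤ S.rate T / 2 + S.C₃ * (∑ τ ∈ Finset.range (T + 1), β τ ^ 2) / ((T : ℝ) + 1) := by
  have hγ := hS.γ_pos
  have hd := hS.d_pos'
  have hl := hS.l_pos'
  have hb := hS.b_pos'
  have hm := hS.m_pos'
  have hL := hS.L_pos
  have h := mul_le_mul_of_nonneg_left (hS.sum_integral_gradMap_le hβ T)
    (by positivity : 0 ≤ 1 / (((T : ℝ) + 1) * S.m))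
  refine h.trans_eq ?_
  have hs : 0 < Real.sqrt (S.l * S.b) := Real.sqrt_pos.2 (by positivity)
  have hs' : 0 < Real.sqrt S.d := Real.sqrt_pos.2 hd
  have hT : (0 : ℝ) < (T : ℝ) + 1 := by positivity
  -- Here `2/(γm) = 20 L√d/√(ℓb)`, half the constant in `rate`.
  unfold rate γ
  field_simp
  ring

theorem rate_nonneg (T : ℕ) : 0 ≤ S.rate T := by
  have hL := hS.L_pos
  have hD : 0 ≤ S.F S.start - S.Fmin := sub_nonneg.2 hS.F_start_ge
  unfold rate
  positivity

end Valid

end Setting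

end VRSZD
end

noncomputable section

namespace VRSZD

namespace Setting

variable {S : Setting.{u}}

/-! ### Counting function evaluations -/

theorem queryAvg_cost (x : Vec S.d) : (S.queryAvg x).cost = S.n := by
  -- Binds unfold definitionally; the summand `0` is the cost of `return`.
  change ∑ _i : Fin S.n, 1 + 0 = S.n
  simp

theorem fullGrad_cost (β : ℝ) (x : Vec S.d) : (S.fullGrad β x).cost = S.n * (S.d + 1) := by
  change (S.queryAvg x).cost + ∑ j : Fin S.d, ((S.queryAvg (x + β • basisVec j)).cost + 0) = _
  simp [queryAvg_cost]
  ring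

theorem stochGrad_cost (hl : S.l ≤ S.d) (β : ℝ) (z : Fin S.n × Orth S.d) (x : Vec S.d) :
    (S.stochGrad β z x).cost = S.l + 1 := by
  change 1 + (∑ _j ∈ Finset.univ.filter (fun j : Fin S.d => (j : ℕ) < S.l), (1 + 0) + 0) = _
  rw [Finset.sum_const, card_filter_lt hl]
  simp [add_comm]

theorem direction_cost (hl : S.l ≤ S.d) (β : ℝ) (g x₀ x : Vec S.d)
    (z : Fin S.b → Fin S.n × Orth S.d) :
    (S.direction β g x₀ x z).cost = S.b * (2 * (S.l + 1)) := by
  change ∑ j, ((S.stochGrad β (z j) x).cost + ((S.stochGrad β (z j) x₀).cost + 0)) + 0 = _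
  simp only [stochGrad_cost hl, Finset.sum_const, Finset.card_univ, Fintype.card_fin, smul_eq_mul]
  ring

theorem inner_cost (hl : S.l ≤ S.d) (β : ℝ) (g x₀ : Vec S.d) (τ : ℕ) (ω : S.Ω) (k : ℕ) :
    (S.inner β g x₀ τ ω k).cost = k * (S.b * (2 * (S.l + 1))) := by
  induction k with
  | zero => exact (Nat.zero_mul _).symm
  | succ k ih =>
    change (S.inner β g x₀ τ ω k).cost + ((S.direction β g x₀ (S.inner β g x₀ τ ω k).val
      (fun j => S.sample τ k j ω)).cost + 0) = _
    rw [ih, direction_cost hl]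
    ring

theorem outer_cost (hl : S.l ≤ S.d) (β : ℕ → ℝ) (ω : S.Ω) (τ : ℕ) :
    (S.outer β ω τ).cost = τ * (S.n * (S.d + 1) + S.m * (S.b * (2 * (S.l + 1)))) := by
  induction τ with
  | zero => exact (Nat.zero_mul _).symm
  | succ τ ih =>
    change (S.outer β ω τ).cost + ((S.fullGrad (β τ) (S.outer β ω τ).val).cost +
      (S.inner (β τ) (S.fullGrad (β τ) (S.outer β ω τ).val).val (S.outer β ω τ).val τ ω
        S.m).cost) = _
    rw [ih, fullGrad_cost, inner_cost hl]
    ring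

/-- The order of magnitude of the number of evaluations in one outer iteration. -/
def outerCost (S : Setting.{u}) : ℝ := S.n * S.d + S.m * S.b * (S.l + 1)

theorem complexity_eq :
    S.complexity = S.outerCost * (Real.sqrt S.d / Real.sqrt (S.l * S.b)) := by
  unfold complexity outerCost
  ring

namespace Valid

variable (hS : S.Valid)

include hS

theorem evals_le (β : ℕ → ℝ) (T : ℕ) (ω : S.Ω) :
    (S.evals β T ω : ℝ) ≤ 2 * ((T : ℝ) + 1) * S.outerCost := by
  unfold evals outerCost
  rw [outer_cost hS.l_le]
  have hd : (1 : ℝ) ≤ S.d := by exact_mod_cast hS.d_pos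
  have h : (S.n : ℝ) * (S.d + 1) ≤ S.n * (2 * S.d) := by
    gcongr
    linarith
  push_cast
  have h2 := mul_le_mul_of_nonneg_left h (by positivity : (0 : ℝ) ≤ T + 1)
  linarith

/-! ### Number of outer iterations and complexity -/

theorem Δ_pos : 0 < S.Δ := by
  unfold Δ
  linarith [hS.L_mul_γ_le]

theorem Δ_ge : 2 / 5 ≤ S.Δ := by
  unfold Δ
  linarith [hS.L_mul_γ_le]

theorem Δ_le : S.Δ ≤ 1 / 2 := by
  unfold Δ
  linarith [mul_pos hS.L_pos hS.γ_pos]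

theorem sub_Fmin_nonneg : 0 ≤ S.F S.start - S.Fmin := sub_nonneg.2 hS.F_start_ge

theorem eta_const_le {β : ℝ} (hβ : 0 < β) (T : ℕ) :
    S.eta (fun _ => β) T ≤ S.rate T / 2 + S.C₃ * β ^ 2 := by
  refine (hS.eta_le (fun _ => hβ) T).trans_eq ?_
  have : (T : ℝ) + 1 ≠ 0 := by positivity
  simp
  field_simp

theorem eta_betaEps_le {ε : ℝ} (hε : 0 < ε) {T : ℕ} (hT : S.outerBound ε ≤ (T : ℝ) + 1) :
    S.eta (S.betaEps ε) T ≤ ε := by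
  have hC := hS.C₃_pos
  have hΔ := hS.Δ_pos
  have hs : 0 < Real.sqrt (S.l * S.b) := Real.sqrt_pos.2 (mul_pos hS.l_pos' hS.b_pos')
  refine (hS.eta_const_le (Real.sqrt_pos.2 (by positivity)) T).trans ?_
  rw [Real.sq_sqrt (by positivity)]
  have e : S.C₃ * (ε / (2 * S.C₃)) = ε / 2 := by field_simp
  rw [e]
  -- Only `rate T / 2` enters, the `β` term taking the other `ε/2`.
  have hr : S.rate T ≤ ε := by
    have e1 : S.rate T = S.Δ * ε / 2 * S.outerBound ε / ((T : ℝ) + 1) := by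
      unfold rate outerBound
      field_simp
      ring
    rw [e1, div_le_iff₀ (by positivity)]
    have h1 : S.Δ * ε / 2 * S.outerBound ε ≤ S.Δ * ε / 2 * ((T : ℝ) + 1) := by gcongr
    have h2 : S.Δ * ε / 2 * ((T : ℝ) + 1) ≤ ε * ((T : ℝ) + 1) := by
      gcongr
      nlinarith [hS.Δ_le]
    linarith
  linarith

theorem outerBound_le {ε : ℝ} (hε : 0 < ε) : S.outerBound ε ≤
    200 * (S.L * (S.F S.start - S.Fmin)) * (Real.sqrt S.d / Real.sqrt (S.l * S.b)) * ε⁻¹ := by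
  have hL := hS.L_pos
  have hD := hS.sub_Fmin_nonneg
  have hΔ := hS.Δ_pos
  have hs : 0 < Real.sqrt (S.l * S.b) := Real.sqrt_pos.2 (mul_pos hS.l_pos' hS.b_pos')
  have e : S.outerBound ε = 80 / S.Δ * ((S.L * (S.F S.start - S.Fmin)) *
      (Real.sqrt S.d / Real.sqrt (S.l * S.b)) * ε⁻¹) := by
    unfold outerBound
    field_simp
  have h : 80 / S.Δ ≤ 200 := by
    rw [div_le_iff₀ hΔ]
    linarith [hS.Δ_ge]
  rw [e]
  refine (mul_le_mul_of_nonneg_right h (by positivity)).trans_eq (by ring)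

/-- An admissible number of outer iterations with a bound on the number of evaluations. -/
theorem exists_outer_iterations {ε : ℝ} (hε : 0 < ε) :
    ∃ T : ℕ, 1 ≤ T ∧ S.outerBound ε ≤ (T : ℝ) + 1 ∧ S.eta (S.betaEps ε) T ≤ ε ∧
      ∀ ω, (S.evals (S.betaEps ε) T ω : ℝ) ≤ S.outerCost *
        (400 * (S.L * (S.F S.start - S.Fmin)) *
          (Real.sqrt S.d / Real.sqrt (S.l * S.b) * ε⁻¹) + 6) := by
  have hL := hS.L_pos
  have hD := hS.sub_Fmin_nonneg
  have hΔ := hS.Δ_pos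
  have h0 : 0 ≤ S.outerBound ε := by
    unfold outerBound
    positivity
  have hT : S.outerBound ε ≤ ((⌈S.outerBound ε⌉₊ + 1 : ℕ) : ℝ) + 1 := by
    push_cast
    linarith [Nat.le_ceil (S.outerBound ε)]
  -- The added one ensures `T ≥ 1` even when the start is already a minimizer and `outerBound`
  -- vanishes.
  refine ⟨⌈S.outerBound ε⌉₊ + 1, by omega, hT, hS.eta_betaEps_le hε hT, fun ω => ?_⟩
  refine (hS.evals_le _ _ ω).trans ?_
  have h1 : ((⌈S.outerBound ε⌉₊ + 1 : ℕ) : ℝ) + 1 ≤ S.outerBound ε + 3 := by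
    push_cast
    linarith [Nat.ceil_lt_add_one h0]
  have hN : 0 ≤ S.outerCost := by
    unfold outerCost
    positivity
  have h2 := hS.outerBound_le hε
  calc 2 * (((⌈S.outerBound ε⌉₊ + 1 : ℕ) : ℝ) + 1) * S.outerCost
      ≤ 2 * (200 * (S.L * (S.F S.start - S.Fmin)) *
        (Real.sqrt S.d / Real.sqrt (S.l * S.b)) * ε⁻¹ + 3) * S.outerCost := by
        refine mul_le_mul_of_nonneg_right ?_ hN
        linarith
    _ = _ := by ring

/-- The sizes of the complexity parameters for batch size `⌈n ^ (2 / 3)⌉`. -/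
theorem outerCost_le_of_batch_size {c : ℝ} (hc : 0 < c) (hb : S.b = ⌈(S.n : ℝ) ^ (2 / 3 : ℝ)⌉₊)
    (hm : S.m = ⌈Real.sqrt S.b⌉₊) (hl : S.l = ⌈(S.d : ℝ) / c⌉₊) :
    S.outerCost ≤ 33 * S.d * ((S.n : ℝ) ^ (1 / 3 : ℝ)) ^ 3 ∧
      Real.sqrt S.d / Real.sqrt (S.l * S.b) ≤ Real.sqrt c / (S.n : ℝ) ^ (1 / 3 : ℝ) := by
  have hd := hS.d_pos'
  have hl0 := hS.l_pos'
  have hb0 := hS.b_pos'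
  have hn : (1 : ℝ) ≤ S.n := by exact_mod_cast hS.n_pos
  -- With `s = n^(1/3)` all sizes are powers of `s`: `b` is between `s²` and `2s²`, and `√b` between
  -- `s` and `2s`.
  set s : ℝ := (S.n : ℝ) ^ (1 / 3 : ℝ) with hs
  have hs1 : 1 ≤ s := Real.one_le_rpow hn (by norm_num)
  have hs2 : (S.n : ℝ) ^ (2 / 3 : ℝ) = s ^ 2 := by
    rw [hs, ← Real.rpow_natCast, ← Real.rpow_mul (by positivity)]
    norm_num
  have hs3 : (S.n : ℝ) = s ^ 3 := by
    rw [hs, ← Real.rpow_natCast, ← Real.rpow_mul (by positivity)]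
    norm_num
  rw [hs2] at hb
  have hb1 : s ^ 2 ≤ S.b := by
    rw [hb]
    exact Nat.le_ceil _
  have hb2 : (S.b : ℝ) ≤ 2 * s ^ 2 := by
    have := Nat.ceil_lt_add_one (sq_nonneg s)
    rw [← hb] at this
    nlinarith
  have hq : Real.sqrt S.b ^ 2 = S.b := Real.sq_sqrt hb0.le
  set q := Real.sqrt S.b with hqdef
  have hq0 : 0 ≤ q := Real.sqrt_nonneg _
  have hsq : s ≤ q := Real.le_sqrt_of_sq_le hb1
  have hqs : q ≤ 2 * s := by
    refine abs_le_of_sq_le_sq' ?_ (by positivity) |>.2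
    nlinarith
  have hm2 : (S.m : ℝ) ≤ 2 * q := by
    have := Nat.ceil_lt_add_one hq0
    rw [← hm] at this
    linarith
  have hd1 : (1 : ℝ) ≤ S.d := by exact_mod_cast hS.d_pos
  have hl1 : (S.l : ℝ) + 1 ≤ 2 * S.d := by
    have : (S.l : ℝ) ≤ S.d := by exact_mod_cast hS.l_le
    linarith
  have hdl : (S.d : ℝ) ≤ c * S.l := by
    have : (S.d : ℝ) / c ≤ S.l := by
      rw [hl]
      exact Nat.le_ceil _
    rwa [div_le_iff₀' hc] at this
  constructor
  · unfold outerCost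
    calc (S.n : ℝ) * S.d + S.m * S.b * (S.l + 1)
        ≤ s ^ 3 * S.d + (2 * q) * q ^ 2 * (2 * S.d) := by
          rw [← hs3, hq]
          gcongr
      _ = s ^ 3 * S.d + 4 * S.d * q ^ 3 := by ring
      _ ≤ s ^ 3 * S.d + 4 * S.d * (2 * s) ^ 3 := by gcongr
      _ = 33 * S.d * s ^ 3 := by ring
  · rw [Real.sqrt_mul hl0.le, ← hqdef]
    have hsl : 0 < Real.sqrt S.l := Real.sqrt_pos.2 hl0
    calc Real.sqrt S.d / (Real.sqrt S.l * q)
        ≤ Real.sqrt (c * S.l) / (Real.sqrt S.l * s) := by gcongr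
      _ = Real.sqrt c / s := by
          rw [Real.sqrt_mul hc.le]
          field_simp

end Valid

end Setting

end VRSZD
end

/-! ### Assembly of the claims -/

theorem corollary1 :
    -- the expectations below are those of integrable random variables
    (∀ S : VRSZD.Setting.{u}, S.Valid → ∀ β : ℕ → ℝ, (∀ τ, 0 < β τ) → ∀ τ k : ℕ, k < S.m →
      MeasureTheory.Integrable (fun ω => ‖S.gradMap S.γ (S.iter β τ k ω)‖ ^ 2) S.P) ∧
    -- (i) square-summable discretization parameters
    (∀ α : ℝ, 1 / 2 < α → ∃ K : ℝ, 0 < K ∧ ∀ S : VRSZD.Setting.{u}, S.Valid →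
      ∀ β : ℝ, 0 < β → ∀ T : ℕ,
        S.eta (fun τ => β / S.d * ((τ : ℝ) + 1) ^ (-α)) T ≤
          S.rate T + K * (S.A * S.L ^ 2 * β ^ 2 / S.d) / ((T : ℝ) + 1)) ∧
    -- (ii) constant discretization parameters
    (∀ S : VRSZD.Setting.{u}, S.Valid → ∀ β : ℝ, 0 < β → ∀ T : ℕ,
        S.eta (fun _ => β / S.d) T ≤
          S.rate T + 4 * S.A * (S.L ^ 2 / S.d) * β ^ 2) ∧
    -- (iii) accuracy
    (∀ S : VRSZD.Setting.{u}, S.Valid → ∀ ε : ℝ, 0 < ε → ε < 1 → ∀ T : ℕ,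
        S.outerBound ε ≤ (T : ℝ) + 1 → S.eta (S.betaEps ε) T ≤ ε) ∧
    -- (iii) function-evaluation complexity
    (∃ K : ℝ, 0 < K ∧ ∀ S : VRSZD.Setting.{u}, S.Valid → ∀ ε : ℝ, 0 < ε → ε < 1 →
      ∃ T : ℕ, 1 ≤ T ∧ S.outerBound ε ≤ (T : ℝ) + 1 ∧ S.eta (S.betaEps ε) T ≤ ε ∧
        (∀ ω, (S.evals (S.betaEps ε) T ω : ℝ) ≤ K * (1 + S.L * (S.F S.start - S.Fmin)) *
          (S.complexity * ε⁻¹ + ((S.n : ℝ) * S.d + (S.m : ℝ) * S.b * ((S.l : ℝ) + 1)))) ∧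
        (ε ≤ Real.sqrt S.d / Real.sqrt (S.l * S.b) →
          ∀ ω, (S.evals (S.betaEps ε) T ω : ℝ) ≤
            K * (1 + S.L * (S.F S.start - S.Fmin)) * (S.complexity * ε⁻¹))) ∧
    -- (iii) function-evaluation complexity for the particular choice of the parameters
    (∀ c : ℝ, 0 < c → ∃ K : ℝ, 0 < K ∧ ∀ S : VRSZD.Setting.{u}, S.Valid →
      S.b = ⌈(S.n : ℝ) ^ (2 / 3 : ℝ)⌉₊ → S.m = ⌈Real.sqrt S.b⌉₊ → S.l = ⌈(S.d : ℝ) / c⌉₊ →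
      ∀ ε : ℝ, 0 < ε → ε < 1 →
      ∃ T : ℕ, 1 ≤ T ∧ S.outerBound ε ≤ (T : ℝ) + 1 ∧ S.eta (S.betaEps ε) T ≤ ε ∧
        (∀ ω, (S.evals (S.betaEps ε) T ω : ℝ) ≤ K * (1 + S.L * (S.F S.start - S.Fmin)) *
          ((S.d : ℝ) * (S.n : ℝ) ^ (2 / 3 : ℝ) * ε⁻¹ + (S.n : ℝ) * S.d)) ∧
        (ε ≤ (S.n : ℝ) ^ (-(1 / 3) : ℝ) →
          ∀ ω, (S.evals (S.betaEps ε) T ω : ℝ) ≤ K * (1 + S.L * (S.F S.start - S.Fmin)) *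
            ((S.d : ℝ) * (S.n : ℝ) ^ (2 / 3 : ℝ) * ε⁻¹))) := by
  refine ⟨fun S hS β _ τ k hk => hS.integrable_gradMap β τ k hk, fun α hα => ?_,
    fun S hS β hβ T => ?_, fun S hS ε hε _ T hT => hS.eta_betaEps_le hε hT,
    ⟨400, by norm_num, fun S hS ε hε _ => ?_⟩,
    fun c hc => ⟨13200 * (Real.sqrt c + 1), by positivity, fun S hS hb hm hl ε hε _ => ?_⟩⟩
  · have hsum : Summable fun τ : ℕ => ((τ : ℝ) + 1) ^ (-(2 * α)) := by
      have h := (summable_nat_add_iff 1).2 (Real.summable_nat_rpow.2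
        (by linarith : -(2 * α) < -1))
      simpa using h
    have h0 : 0 ≤ ∑' τ : ℕ, ((τ : ℝ) + 1) ^ (-(2 * α)) := tsum_nonneg fun τ => by positivity
    -- The `4` comes from `C₃`; the `+ 1` only makes positivity immediate.
    refine ⟨4 * ∑' τ : ℕ, ((τ : ℝ) + 1) ^ (-(2 * α)) + 1, by positivity,
      fun S hS β hβ T => ?_⟩
    have hd := hS.d_pos'
    have hA : 0 < S.A := by
      unfold VRSZD.Setting.A
      positivity
    refine (hS.eta_le (fun τ => by positivity) T).trans ?_
    have hT : ∑ τ ∈ Finset.range (T + 1), (β / S.d * ((τ : ℝ) + 1) ^ (-α)) ^ 2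
        ≤ (β / S.d) ^ 2 * ∑' τ : ℕ, ((τ : ℝ) + 1) ^ (-(2 * α)) := by
      have e (τ : ℕ) : (β / S.d * ((τ : ℝ) + 1) ^ (-α)) ^ 2
          = (β / S.d) ^ 2 * ((τ : ℝ) + 1) ^ (-(2 * α)) := by
        rw [mul_pow, ← Real.rpow_natCast (((τ : ℝ) + 1) ^ (-α)), ← Real.rpow_mul (by positivity)]
        congr 2
        push_cast
        ring
      simp_rw [e]
      rw [← Finset.mul_sum]
      gcongr
      exact hsum.sum_le_tsum _ fun τ _ => by positivity
    have hr := hS.rate_nonneg T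
    have hC := hS.C₃_pos
    refine add_le_add (by linarith) (div_le_div_of_nonneg_right ?_ (by positivity))
    refine (mul_le_mul_of_nonneg_left hT hC.le).trans ?_
    have e : S.C₃ * ((β / S.d) ^ 2 * ∑' τ : ℕ, ((τ : ℝ) + 1) ^ (-(2 * α)))
        = 4 * (∑' τ : ℕ, ((τ : ℝ) + 1) ^ (-(2 * α))) * (S.A * S.L ^ 2 * β ^ 2 / S.d) := by
      unfold VRSZD.Setting.C₃
      field_simp
    rw [e]
    have : 0 ≤ S.A * S.L ^ 2 * β ^ 2 / S.d := by positivity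
    gcongr
    linarith
  · have hd := hS.d_pos'
    have hr := hS.rate_nonneg T
    refine (hS.eta_const_le (by positivity) T).trans (add_le_add (by linarith) (le_of_eq ?_))
    unfold VRSZD.Setting.C₃
    field_simp
  · obtain ⟨T, h1, h2, h3, h4⟩ := hS.exists_outer_iterations hε
    have hN : 0 ≤ S.outerCost := by
      unfold VRSZD.Setting.outerCost
      positivity
    have hLD : 0 ≤ S.L * (S.F S.start - S.Fmin) := mul_nonneg hS.L_pos.le hS.sub_Fmin_nonneg
    rw [VRSZD.Setting.complexity_eq]
    set r := Real.sqrt S.d / Real.sqrt (S.l * S.b)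
    have hr : 0 ≤ r * ε⁻¹ := by positivity
    refine ⟨T, h1, h2, h3, fun ω => (h4 ω).trans ?_, fun hε' ω => (h4 ω).trans ?_⟩
    · change _ ≤ 400 * (1 + S.L * (S.F S.start - S.Fmin)) * (S.outerCost * r * ε⁻¹ + S.outerCost)
      rw [show 400 * (1 + S.L * (S.F S.start - S.Fmin)) * (S.outerCost * r * ε⁻¹ + S.outerCost)
        = S.outerCost * (400 * (1 + S.L * (S.F S.start - S.Fmin)) * (r * ε⁻¹ + 1)) by ring]
      refine mul_le_mul_of_nonneg_left ?_ hN
      nlinarith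
    · rw [show 400 * (1 + S.L * (S.F S.start - S.Fmin)) * (S.outerCost * r * ε⁻¹)
        = S.outerCost * (400 * (1 + S.L * (S.F S.start - S.Fmin)) * (r * ε⁻¹)) by ring]
      refine mul_le_mul_of_nonneg_left ?_ hN
      -- The smallness of `ε` lets the leading term absorb the cost of the constantly many extra
      -- outer iterations.
      have : 1 ≤ r * ε⁻¹ := by rwa [← div_eq_mul_inv, one_le_div hε]
      nlinarith
  · obtain ⟨T, h1, h2, h3, h4⟩ := hS.exists_outer_iterations hε
    obtain ⟨hN, hr⟩ := hS.outerCost_le_of_batch_size hc hb hm hl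
    have hLD : 0 ≤ S.L * (S.F S.start - S.Fmin) := mul_nonneg hS.L_pos.le hS.sub_Fmin_nonneg
    have hn : (1 : ℝ) ≤ S.n := by exact_mod_cast hS.n_pos
    have hs2 : (S.n : ℝ) ^ (2 / 3 : ℝ) = ((S.n : ℝ) ^ (1 / 3 : ℝ)) ^ 2 := by
      rw [← Real.rpow_natCast, ← Real.rpow_mul (by positivity)]
      norm_num
    have hs3 : (S.n : ℝ) = ((S.n : ℝ) ^ (1 / 3 : ℝ)) ^ 3 := by
      rw [← Real.rpow_natCast, ← Real.rpow_mul (by positivity)]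
      norm_num
    have hsn : (S.n : ℝ) ^ (-(1 / 3) : ℝ) = ((S.n : ℝ) ^ (1 / 3 : ℝ))⁻¹ :=
      Real.rpow_neg (by positivity) _
    have hs1 : 1 ≤ (S.n : ℝ) ^ (1 / 3 : ℝ) := Real.one_le_rpow hn (by norm_num)
    rw [hs2, hsn]
    set s : ℝ := (S.n : ℝ) ^ (1 / 3 : ℝ)
    set LD := S.L * (S.F S.start - S.Fmin)
    have hc' := Real.sqrt_nonneg c
    have hd := hS.d_pos'
    -- `13200 = 33 * 400` and `198 = 33 * 6`.
    have h5 (ω : S.Ω) : (S.evals (S.betaEps ε) T ω : ℝ) ≤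
        13200 * Real.sqrt c * LD * (S.d * s ^ 2 * ε⁻¹) + 198 * (S.d * s ^ 3) :=
      calc (S.evals (S.betaEps ε) T ω : ℝ)
          ≤ 33 * S.d * s ^ 3 * (400 * LD * (Real.sqrt c / s * ε⁻¹) + 6) := by
            refine (h4 ω).trans ?_
            gcongr
        _ = _ := by
            field_simp
            ring
    have hx : 0 ≤ (S.d : ℝ) * s ^ 2 * ε⁻¹ := by positivity
    have hy : 0 ≤ (S.d : ℝ) * s ^ 3 := by positivity
    refine ⟨T, h1, h2, h3, fun ω => (h5 ω).trans ?_, fun hε' ω => (h5 ω).trans ?_⟩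
    · rw [hs3, mul_comm (s ^ 3)]
      generalize (S.d : ℝ) * s ^ 2 * ε⁻¹ = x at *
      generalize (S.d : ℝ) * s ^ 3 = y at *
      have e : 13200 * (Real.sqrt c + 1) * (1 + LD) * (x + y)
          = 13200 * Real.sqrt c * LD * x + 13200 * y + (13200 * (Real.sqrt c + LD + 1) * x
            + 13200 * (Real.sqrt c + LD + Real.sqrt c * LD) * y) := by ring
      have : 0 ≤ 13200 * (Real.sqrt c + LD + 1) * x
            + 13200 * (Real.sqrt c + LD + Real.sqrt c * LD) * y := by positivity
      rw [e]
      linarith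
    -- For `ε ≤ n^(-1/3)` the term `nd = d s³` is dominated by the leading one.
    · have hyx : (S.d : ℝ) * s ^ 3 ≤ S.d * s ^ 2 * ε⁻¹ := by
        have : s ≤ ε⁻¹ := by
          rw [le_inv_comm₀ (by positivity) hε]
          exact hε'
        calc (S.d : ℝ) * s ^ 3 = S.d * s ^ 2 * s := by ring
          _ ≤ _ := by gcongr
      generalize (S.d : ℝ) * s ^ 2 * ε⁻¹ = x at *
      generalize (S.d : ℝ) * s ^ 3 = y at *
      have e : 13200 * (Real.sqrt c + 1) * (1 + LD) * x
          = 13200 * Real.sqrt c * LD * x + 13200 * x + 13200 * (Real.sqrt c + LD) * x := by ring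
      have : 0 ≤ 13200 * (Real.sqrt c + LD) * x := by positivity
      rw [e]
      linarith
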